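/- Let $L'\subset \mathrm{GL}_4(\mathbb R)$ be the Lie group of matrices $$\begin{pmatrix}1&0&b&\tfrac12 b^2-a\\0&e^a&0&0\\0&0&1&b\\0&0&0&1\end{pmatrix},\qquad a,b\in\mathbb R,$$ acting on affine space $\mathbb R^3=\{[x_1:x_2:x_3:1]\}$. This action preserves the family of lines parallel to the $x_1$-axis, so $L'$ also acts by affine maps on the $(x_2,x_3)$-plane, preserving the half-plane $U=\{x_2>0\}$. For $\kappa\in\mathbb R$ let $\mathcal H'_\kappa=L'\cdot(\kappa,1,0)$, let $D'$ be the epigraph, in the $x_1$-direction, of the orbit $\mathcal H'_0$ (that is, $D'=\{x_2>0,\ x_1>\tfrac12x_3^2-\log x_2\}$, a properly convex domain), and for $k>0$ let $D'_k=\bigcup_{s>k}\mathcal H'_s$ be the $L'$-horoball. The Hilbert metric of $D'$ is $d_{D'}(x,y)=\log\frac{|y-a||x-b|}{|y-b||x-a|}$, where the line through $x,y$ meets $\partial D'$ in $a,b$, with $a,x,y,b$ in this order (ratios involving a point at infinity being $1$). The Busemann volume on $D'$ is the $3$-dimensional Hausdorff measure of $d_{D'}$, multiplied by the Lebesgue measure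 of a Euclidean ball of diameter $1$. The Hilbert norm at $x\in D'$ is $\|v\|_{D'}=|v|\left(\frac1{|x-p_-|}+\frac1{|x-p_+|}\right)$, where $p_\pm$ are the points in which the line through $x$ with direction $v$ meets $\partial D'$ (with $1/\infty=0$), and $B^{D'}_x(1)$ is its unit ball. A fundamental domain for a group action is a measurable set whose translates cover the space and are pairwise disjoint, up to Lebesgue null sets. Let $\Gamma$ be a lattice in $L'$. Then there is a compact fundamental domain $R\subset U$ for the affine action of $\Gamma$ on $U$. For every such $R$, put $\mathcal D_k=\{x\in D'_k \mid (x_2,x_3)\in R\}$ for $k>0$. Then: 1. For every $k>0$, $\mathcal D_k$ is a fundamental domain for the action of $\Gamma$ on $D'_k$, and $\mathcal D_k$ has finite Busemann volume as a subset of $D'$. 2. There are constants $C>0$ and $N$, depending only on $\Gamma$ and $R$, such that for all $k>0$ and all $x\in\mathcal D_k$ with $x_1>N$, the Lebesgue measure of $B^{D'}_x(1)$ is greater than $C\,x_1^{3/2}$. Moreover, for every $k>0$, every fundamental domain $E\subset D'_k$ for the action of $\Gamma$ on $D'_k$ has finite Busemann volume as a subset of $D'$. -/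

import Mathlib

open MeasureTheory
open scoped ENNReal

noncomputable section

namespace CuspVolume

/-! ### Hilbert geometry of a properly convex domain in an affine patch -/

/-- The rate `1 / τ`, where `τ ∈ (0, ∞]` is the time at which the ray `x + t v`, `t ≥ 0`,
leaves `Ω`; it is `0` if the ray never leaves `Ω` (it then leaves `Ω` at infinity). -/
def exitRate {n : ℕ} (Ω : Set (EuclideanSpace ℝ (Fin n))) (x v : EuclideanSpace ℝ (Fin n)) : ℝ :=
  gauge {w | x + w ∈ Ω} v

/-- The Hilbert distance `log [a : x : y : b]`, with
`[a : x : y : b] = (|y - a| |x - b|) / (|y - b| |x - a|)`,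
where the line through `x` and `y` leaves `Ω` at `b` (beyond `y`) and at `a` (beyond `x`).
As `b = x + (y - x) / r` with `r = exitRate Ω x (y - x)`, one has `|x - b| / |y - b| = 1 / (1 - r)`,
also when `b` is at infinity (`r = 0`); similarly for `a`. See `hilbertDist_eq_log_crossRatio`. -/
def hilbertDist {n : ℕ} (Ω : Set (EuclideanSpace ℝ (Fin n))) (x y : EuclideanSpace ℝ (Fin n)) : ℝ :=
  Real.log ((1 - exitRate Ω x (y - x))⁻¹ * (1 - exitRate Ω y (x - y))⁻¹)

/-- The Hilbert norm of a tangent vector `v` at `x`, namely `|v| (1 / |x - p₊| + 1 / |x - p₋|)`,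
where `p₊` and `p₋` are the points where the line through `x` in direction `v` leaves `Ω`
(with `1 / ∞ = 0`). -/
def hilbertNorm {n : ℕ} (Ω : Set (EuclideanSpace ℝ (Fin n)))
    (x v : EuclideanSpace ℝ (Fin n)) : ℝ :=
  exitRate Ω x v + exitRate Ω x (-v)

/-- The unit ball of the Hilbert norm in the tangent space at `x`. -/
def hilbertUnitBall {n : ℕ} (Ω : Set (EuclideanSpace ℝ (Fin n)))
    (x : EuclideanSpace ℝ (Fin n)) : Set (EuclideanSpace ℝ (Fin n)) :=
  {v | hilbertNorm Ω x v < 1}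

/-- A properly convex domain, seen in an affine patch that contains it: an open convex set that
contains no complete affine line. -/
structure IsProperlyConvex {n : ℕ} (Ω : Set (EuclideanSpace ℝ (Fin n))) : Prop where
  isOpen : IsOpen Ω
  convex : Convex ℝ Ω
  no_line : ∀ x v : EuclideanSpace ℝ (Fin n), v ≠ 0 → ∃ t : ℝ, x + t • v ∉ Ω

section Hilbert

variable {n : ℕ} {Ω : Set (EuclideanSpace ℝ (Fin n))}

lemma isOpen_shift (ho : IsOpen Ω) (x : EuclideanSpace ℝ (Fin n)) : IsOpen {w | x + w ∈ Ω} :=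
  ho.preimage (continuous_const.add continuous_id)

lemma absorbent_shift (ho : IsOpen Ω) {x : EuclideanSpace ℝ (Fin n)} (hx : x ∈ Ω) :
    Absorbent ℝ {w | x + w ∈ Ω} :=
  absorbent_nhds_zero ((isOpen_shift ho x).mem_nhds (by simpa using hx))

lemma exitRate_nonneg (x v : EuclideanSpace ℝ (Fin n)) : 0 ≤ exitRate Ω x v := gauge_nonneg _

lemma exitRate_lt_one (ho : IsOpen Ω) {x y : EuclideanSpace ℝ (Fin n)} (hy : y ∈ Ω) :
    exitRate Ω x (y - x) < 1 :=
  gauge_lt_one_of_mem_of_isOpen (isOpen_shift ho x) (by simpa using hy)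

lemma exitRate_exists {x y : EuclideanSpace ℝ (Fin n)} (ho : IsOpen Ω) (hx : x ∈ Ω) {r : ℝ}
    (h : exitRate Ω x (y - x) < r) : ∃ s, 0 < s ∧ s < r ∧ ∃ u ∈ Ω, y - x = s • (u - x) := by
  obtain ⟨s, hs, hsr, w, hw, hwy⟩ := exists_lt_of_gauge_lt (absorbent_shift ho hx) h
  exact ⟨s, hs, hsr, x + w, hw, by simpa using hwy.symm⟩

lemma exitRate_triangle (ho : IsOpen Ω) (hc : Convex ℝ Ω) {x y z : EuclideanSpace ℝ (Fin n)}
    (hx : x ∈ Ω) (hy : y ∈ Ω) (hz : z ∈ Ω) :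
    (1 - exitRate Ω x (y - x)) * (1 - exitRate Ω y (z - y)) ≤ 1 - exitRate Ω x (z - x) := by
  have h1 := exitRate_lt_one (x := x) ho hy
  have h2 := exitRate_lt_one (x := y) ho hz
  have key : ∀ r s : ℝ, exitRate Ω x (y - x) < r → r < 1 → exitRate Ω y (z - y) < s → s < 1 →
      (1 - r) * (1 - s) ≤ 1 - exitRate Ω x (z - x) := by
    intro r s hr hr1 hs hs1
    obtain ⟨r', hr0, hrr, u, hu, hyu⟩ := exitRate_exists ho hx hr
    obtain ⟨s', hs0, hss, w, hw, hzw⟩ := exitRate_exists ho hy hs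
    have hρ : 0 < (1 - s') * r' + s' := by nlinarith
    have hmem : exitRate Ω x (z - x) ≤ (1 - s') * r' + s' := by
      refine gauge_le_of_mem hρ.le ?_
      refine ⟨(((1 - s') * r') / ((1 - s') * r' + s')) • u +
        (s' / ((1 - s') * r' + s')) • w - x, ?_, ?_⟩
      · simp only [Set.mem_ofPred_eq, add_sub_cancel]
        refine hc hu hw (div_nonneg (by nlinarith) hρ.le) (div_nonneg hs0.le hρ.le) ?_
        rw [← add_div, div_self hρ.ne']
      · have e : z - x = ((1 - s') * r') • (u - x) + s' • (w - x) := by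
          have e1 : z - x = (z - y) + (y - x) := by abel
          have e2 : w - y = (w - x) - (y - x) := by abel
          rw [e1, hzw, e2, hyu]
          module
        simp only
        rw [e, smul_sub, smul_add, smul_smul, smul_smul, mul_div_cancel₀ _ hρ.ne',
          mul_div_cancel₀ _ hρ.ne']
        module
    nlinarith
  have step1 : ∀ s : ℝ, exitRate Ω y (z - y) < s → s < 1 →
      (1 - exitRate Ω x (y - x)) * (1 - s) ≤ 1 - exitRate Ω x (z - x) := by
    intro s hs hs1
    have hs2 : 0 < 1 - s := by linarith
    rw [← le_div_iff₀ hs2]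
    refine le_of_forall_lt_imp_le_of_dense fun a ha => ?_
    rw [le_div_iff₀ hs2]
    rcases le_or_gt a 0 with h | h
    · have := exitRate_lt_one (x := x) ho hz
      nlinarith
    · have := key (1 - a) s (by linarith) (by linarith) hs hs1
      simpa using this
  have hr2 : 0 < 1 - exitRate Ω x (y - x) := by linarith
  rw [mul_comm, ← le_div_iff₀ hr2]
  refine le_of_forall_lt_imp_le_of_dense fun a ha => ?_
  rw [le_div_iff₀ hr2]
  rcases le_or_gt a 0 with h | h
  · have := exitRate_lt_one (x := x) ho hz
    nlinarith
  · have := step1 (1 - a) (by linarith) (by linarith)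
    rw [mul_comm]
    simpa using this

lemma hilbertDist_self (x : EuclideanSpace ℝ (Fin n)) : hilbertDist Ω x x = 0 := by
  simp [hilbertDist, exitRate]

lemma hilbertDist_comm (x y : EuclideanSpace ℝ (Fin n)) :
    hilbertDist Ω x y = hilbertDist Ω y x := by
  rw [hilbertDist, hilbertDist, mul_comm]

lemma hilbertDist_triangle (ho : IsOpen Ω) (hc : Convex ℝ Ω) {x y z : EuclideanSpace ℝ (Fin n)}
    (hx : x ∈ Ω) (hy : y ∈ Ω) (hz : z ∈ Ω) :
    hilbertDist Ω x z ≤ hilbertDist Ω x y + hilbertDist Ω y z := by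
  have p : ∀ {a b : EuclideanSpace ℝ (Fin n)}, b ∈ Ω → 0 < 1 - exitRate Ω a (b - a) :=
    fun {a _} h => by linarith [exitRate_lt_one (x := a) ho h]
  have t1 := exitRate_triangle ho hc hx hy hz
  have t2 := exitRate_triangle ho hc hz hy hx
  have pxy := p (a := x) hy
  have pyx := p (a := y) hx
  have pyz := p (a := y) hz
  have pzy := p (a := z) hy
  unfold hilbertDist
  rw [← Real.log_mul (by positivity) (by positivity)]
  refine Real.log_le_log (mul_pos (inv_pos.2 (p hz)) (inv_pos.2 (p hx))) ?_
  have i1 := inv_anti₀ (by positivity) t1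
  have i2 := inv_anti₀ (by positivity) t2
  calc _ ≤ _ := mul_le_mul i1 i2 (inv_pos.2 (p hx)).le (by positivity)
    _ = _ := by rw [mul_inv, mul_inv]; ring

lemma mem_of_exitRate_eq_zero (ho : IsOpen Ω) (hc : Convex ℝ Ω) {x v : EuclideanSpace ℝ (Fin n)}
    (hx : x ∈ Ω) (h : exitRate Ω x v = 0) {t : ℝ} (ht : 0 ≤ t) : x + t • v ∈ Ω := by
  have h1 : exitRate Ω x (x + t • v - x) = 0 := by
    rw [add_sub_cancel_left, exitRate, gauge_smul_of_nonneg ht]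
    simp only [exitRate] at h
    simp [h]
  obtain ⟨s, hs, hs1, u, hu, e⟩ := exitRate_exists ho hx (r := 1) (by rw [h1]; norm_num)
  have : x + t • v = (1 - s) • x + s • u := by
    rw [add_sub_cancel_left] at e
    rw [e]; module
  rw [this]
  exact hc hx hu (by linarith) hs.le (by ring)

lemma eq_of_hilbertDist_eq_zero (h : IsProperlyConvex Ω) {x y : EuclideanSpace ℝ (Fin n)}
    (hx : x ∈ Ω) (hy : y ∈ Ω) (hd : hilbertDist Ω x y = 0) : x = y := by
  by_contra hne
  have r0 := exitRate_nonneg (Ω := Ω) x (y - x)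
  have s0 := exitRate_nonneg (Ω := Ω) y (x - y)
  have r1 := exitRate_lt_one (x := x) h.isOpen hy
  have s1 := exitRate_lt_one (x := y) h.isOpen hx
  have pr : 0 < 1 - exitRate Ω x (y - x) := by linarith
  have ps : 0 < 1 - exitRate Ω y (x - y) := by linarith
  have e : (1 - exitRate Ω x (y - x)) * (1 - exitRate Ω y (x - y)) = 1 := by
    have := Real.eq_one_of_pos_of_log_eq_zero (by positivity) hd
    rwa [← mul_inv, inv_eq_one] at this
  have er : exitRate Ω x (y - x) = 0 := by nlinarith
  have es : exitRate Ω y (x - y) = 0 := by nlinarith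
  obtain ⟨t, ht⟩ := h.no_line x (y - x) (sub_ne_zero.2 (Ne.symm hne))
  rcases le_total 0 t with h0 | h0
  · exact ht (mem_of_exitRate_eq_zero h.isOpen h.convex hx er h0)
  · have := mem_of_exitRate_eq_zero h.isOpen h.convex hy es (t := 1 - t) (by linarith)
    apply ht
    convert this using 1
    module

/-- If the ray from `x` through `y` meets the boundary of `Ω` at `b` and the ray from `y` through
`x` meets it at `a`, then `hilbertDist` is the logarithm of the cross ratio of `a, x, y, b`. -/
lemma hilbertDist_eq_log_crossRatio (ho : IsOpen Ω) (hc : Convex ℝ Ω)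
    {x y a b : EuclideanSpace ℝ (Fin n)} (hx : x ∈ Ω) (hy : y ∈ Ω) (hxy : x ≠ y)
    (ha : a ∈ frontier Ω) (hb : b ∈ frontier Ω) {s t : ℝ} (hs : 0 < s) (ht : 0 < t)
    (hbt : b = x + t • (y - x)) (has : a = y + s • (x - y)) :
    hilbertDist Ω x y =
      Real.log ((dist y a * dist x b) / (dist y b * dist x a)) := by
  have hA : ∀ {p q c : EuclideanSpace ℝ (Fin n)} {τ : ℝ}, p ∈ Ω → q ∈ Ω → p ≠ q →
      c ∈ frontier Ω → 0 < τ → c = p + τ • (q - p) →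
      (1 - exitRate Ω p (q - p))⁻¹ = dist p c / dist q c ∧ 0 < dist p c / dist q c := by
    intro p q c τ hp hq hpq hcf hτ hcτ
    have h1 : exitRate Ω p (c - p) = 1 := by
      have hcv : Convex ℝ {w | p + w ∈ Ω} := hc.translate_preimage_right p
      rw [exitRate, gauge_eq_one_iff_mem_frontier hcv
        ((isOpen_shift ho p).mem_nhds (by simpa using hp))]
      have : {w | p + w ∈ Ω} = (Homeomorph.addLeft p) ⁻¹' Ω := rfl
      rw [this, ← Homeomorph.preimage_frontier]
      simpa using hcf
    have h2 : τ * exitRate Ω p (q - p) = 1 := by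
      rw [← h1, hcτ, add_sub_cancel_left, exitRate, exitRate, gauge_smul_of_nonneg hτ.le,
        smul_eq_mul]
    have h3 := exitRate_lt_one (x := p) ho hq
    have hτ1 : 1 < τ := by nlinarith [exitRate_nonneg (Ω := Ω) p (q - p)]
    have hpos : 0 < dist p q := dist_pos.2 hpq
    have d1 : dist p c = τ * dist p q := by
      rw [hcτ, dist_self_add_right, norm_smul, Real.norm_of_nonneg hτ.le, dist_comm, dist_eq_norm]
    have d2 : dist q c = (τ - 1) * dist p q := by
      have : c - q = (τ - 1) • (q - p) := by rw [hcτ]; module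
      rw [dist_comm, dist_eq_norm, this, norm_smul, Real.norm_of_nonneg (by linarith),
        dist_comm p q, dist_eq_norm]
    have hτ2 : 0 < τ - 1 := by linarith
    have e : exitRate Ω p (q - p) = 1 / τ := by field_simp; linarith
    rw [d1, d2, e]
    refine ⟨?_, by positivity⟩
    have : (1 - 1 / τ) = (τ - 1) / τ := by field_simp
    rw [this]
    field_simp
  obtain ⟨e1, -⟩ := hA hx hy hxy hb ht hbt
  obtain ⟨e2, -⟩ := hA hy hx hxy.symm ha hs has
  rw [hilbertDist, e1, e2]
  congr 1
  ring

end Hilbert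

/-- A properly convex domain as a space of its own, which carries the Hilbert metric. -/
def HilbertSpaceOf {n : ℕ} {Ω : Set (EuclideanSpace ℝ (Fin n))} (_ : IsProperlyConvex Ω) : Type :=
  Ω

/-- The underlying point of the affine patch. -/
def HilbertSpaceOf.point {n : ℕ} {Ω : Set (EuclideanSpace ℝ (Fin n))} {h : IsProperlyConvex Ω}
    (p : HilbertSpaceOf h) : EuclideanSpace ℝ (Fin n) := Subtype.val p

instance {n : ℕ} {Ω : Set (EuclideanSpace ℝ (Fin n))} (h : IsProperlyConvex Ω) :
    MetricSpace (HilbertSpaceOf h) where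
  dist p q := hilbertDist Ω p.point q.point
  dist_self p := hilbertDist_self p.point
  dist_comm p q := hilbertDist_comm p.point q.point
  dist_triangle p q r := hilbertDist_triangle h.isOpen h.convex p.2 q.2 r.2
  eq_of_dist_eq_zero {p q} hd := Subtype.ext (eq_of_hilbertDist_eq_zero h p.2 q.2 hd)

instance {n : ℕ} {Ω : Set (EuclideanSpace ℝ (Fin n))} (h : IsProperlyConvex Ω) :
    MeasurableSpace (HilbertSpaceOf h) := borel _

instance {n : ℕ} {Ω : Set (EuclideanSpace ℝ (Fin n))} (h : IsProperlyConvex Ω) :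
    BorelSpace (HilbertSpaceOf h) := ⟨rfl⟩

/-- The Busemann volume: the `n`-dimensional Hausdorff measure of the Hilbert metric, normalized by
the Lebesgue measure of the Euclidean ball of diameter `1`. -/
def busemannMeasure {n : ℕ} {Ω : Set (EuclideanSpace ℝ (Fin n))} (h : IsProperlyConvex Ω) :
    Measure (HilbertSpaceOf h) :=
  volume (Metric.ball (0 : EuclideanSpace ℝ (Fin n)) (1 / 2)) • Measure.hausdorffMeasure (n : ℝ)

/-- The Busemann volume of (the part in `Ω` of) a subset `E` of the affine patch. -/
def busemannVolume {n : ℕ} {Ω : Set (EuclideanSpace ℝ (Fin n))} (h : IsProperlyConvex Ω)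
    (E : Set (EuclideanSpace ℝ (Fin n))) : ℝ≥0∞ :=
  busemannMeasure h {p | p.point ∈ E}

/-! ### Lattices in topological groups -/

/-- A lattice in a topological group `G`: a discrete subgroup `Γ` of finite covolume, that is, such
that `G ⧸ Γ` carries a nonzero finite `G`-invariant Borel measure. -/
structure IsLatticeIn {G : Type*} [Group G] [TopologicalSpace G] (Γ : Subgroup G) : Prop where
  discrete : DiscreteTopology Γ
  finite_covolume : ∃ ν : @Measure (G ⧸ Γ) (borel (G ⧸ Γ)), ν ≠ 0 ∧ ν Set.univ < ∞ ∧
    ∀ (g : G) (E : Set (G ⧸ Γ)), @MeasurableSet _ (borel (G ⧸ Γ)) E →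
      ν ((fun q => g • q) ⁻¹' E) = ν E

/-! ### The group `L'` and its actions -/

/-- The matrices that make up `L'`. -/
def matL (a b : ℝ) : Matrix (Fin 4) (Fin 4) ℝ :=
  !![1, 0, b, b ^ 2 / 2 - a;
     0, Real.exp a, 0, 0;
     0, 0, 1, b;
     0, 0, 0, 1]

lemma matL_mul (a b c d : ℝ) : matL a b * matL c d = matL (a + c) (b + d) := by
  ext i j
  fin_cases i <;> fin_cases j <;>
    simp [matL, Matrix.mul_apply, Fin.sum_univ_four, Real.exp_add] <;> ring

lemma matL_zero : matL 0 0 = 1 := by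
  ext i j
  fin_cases i <;> fin_cases j <;> simp [matL]

/-- The Lie group `L'`, with the topology of `GL(4, ℝ)`. -/
def groupL : Subgroup (GL (Fin 4) ℝ) where
  carrier := {g | ∃ a b : ℝ, (g : Matrix (Fin 4) (Fin 4) ℝ) = matL a b}
  mul_mem' := by
    rintro g h ⟨a, b, hg⟩ ⟨c, d, hh⟩
    exact ⟨a + c, b + d, by rw [Units.val_mul, hg, hh, matL_mul]⟩
  one_mem' := ⟨0, 0, by rw [matL_zero]; rfl⟩
  inv_mem' := by
    rintro g ⟨a, b, hg⟩
    refine ⟨-a, -b, ?_⟩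
    have h : (g : Matrix (Fin 4) (Fin 4) ℝ) * matL (-a) (-b) = 1 := by
      rw [hg, matL_mul, add_neg_cancel, add_neg_cancel, matL_zero]
    calc ((g⁻¹ : GL (Fin 4) ℝ) : Matrix (Fin 4) (Fin 4) ℝ)
        = ((g⁻¹ : GL (Fin 4) ℝ) : Matrix (Fin 4) (Fin 4) ℝ) * ((g : Matrix (Fin 4) (Fin 4) ℝ) *
            matL (-a) (-b)) := by rw [h, mul_one]
      _ = matL (-a) (-b) := by rw [← mul_assoc, ← Units.val_mul, inv_mul_cancel, Units.val_one,
            one_mul]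

/-- The underlying matrix of an element of `L'`. -/
def mat (g : groupL) : Matrix (Fin 4) (Fin 4) ℝ := g.1.1

/-- The homogeneous coordinates `(x₁, x₂, x₃, 1)` of a point of affine 3-space. -/
def homog (x : EuclideanSpace ℝ (Fin 3)) : Fin 4 → ℝ := ![x 0, x 1, x 2, 1]

/-- `L'` acts on affine 3-space `{[x₁ : x₂ : x₃ : 1]}` by matrix multiplication. -/
instance : SMul groupL (EuclideanSpace ℝ (Fin 3)) where
  smul g x :=
    let y := (mat g).mulVec (homog x)
    !₂[y 0, y 1, y 2]

lemma smul_def3 (g : groupL) {a b : ℝ} (hg : mat g = matL a b)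
    (x : EuclideanSpace ℝ (Fin 3)) :
    g • x = !₂[x 0 + b * x 2 + (b ^ 2 / 2 - a), Real.exp a * x 1, x 2 + b] := by
  change !₂[(mat g).mulVec (homog x) 0, _, _] = _
  ext i
  fin_cases i <;> simp [hg, matL, homog, Matrix.mulVec, dotProduct, Fin.sum_univ_four]

/-- As the matrices in `L'` have last row `(0, 0, 0, 1)`, they preserve the affine patch, and the
action is given by homogeneous coordinates without any rescaling. -/
lemma homog_smul (g : groupL) (x : EuclideanSpace ℝ (Fin 3)) :
    homog (g • x) = (mat g).mulVec (homog x) := by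
  obtain ⟨a, b, hg⟩ := g.2
  replace hg : mat g = matL a b := hg
  rw [smul_def3 g hg]
  ext i
  fin_cases i <;> simp [hg, matL, homog, Matrix.mulVec, dotProduct, Fin.sum_univ_four]

lemma homog_injective : Function.Injective homog := by
  intro x y h
  ext i
  fin_cases i
  · exact congrFun h 0
  · exact congrFun h 1
  · exact congrFun h 2

instance : MulAction groupL (EuclideanSpace ℝ (Fin 3)) where
  one_smul x := homog_injective (by rw [homog_smul]; simp [mat])
  mul_smul g h x := homog_injective (by
    rw [homog_smul, homog_smul, homog_smul, Matrix.mulVec_mulVec]; rfl)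

/-- The vertical projection `[x₁ : x₂ : x₃ : 1] ↦ [x₂ : x₃ : 1]`. -/
def proj (x : EuclideanSpace ℝ (Fin 3)) : EuclideanSpace ℝ (Fin 2) := !₂[x 1, x 2]

/-- The affine action of `L'` on affine 2-space, which is the space of vertical lines. -/
instance : SMul groupL (EuclideanSpace ℝ (Fin 2)) where
  smul g z := proj (g • (!₂[0, z 0, z 1] : EuclideanSpace ℝ (Fin 3)))

lemma smul_def2 (g : groupL) {a b : ℝ} (hg : mat g = matL a b)
    (z : EuclideanSpace ℝ (Fin 2)) : g • z = !₂[Real.exp a * z 0, z 1 + b] := by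
  change proj (g • (!₂[0, z 0, z 1] : EuclideanSpace ℝ (Fin 3))) = _
  rw [smul_def3 g hg]
  simp [proj]

/-- The action on affine 2-space does not depend on the point chosen on a vertical line. -/
lemma proj_smul (g : groupL) (x : EuclideanSpace ℝ (Fin 3)) : proj (g • x) = g • proj x := by
  obtain ⟨a, b, hg⟩ := g.2
  replace hg : mat g = matL a b := hg
  rw [smul_def3 g hg, smul_def2 g hg]
  simp [proj]

lemma proj_surjective : Function.Surjective proj := fun z => by
  refine ⟨!₂[0, z 0, z 1], ?_⟩
  ext i
  fin_cases i <;> simp [proj]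

instance : MulAction groupL (EuclideanSpace ℝ (Fin 2)) where
  one_smul z := by
    obtain ⟨x, rfl⟩ := proj_surjective z
    rw [← proj_smul, one_smul]
  mul_smul g h z := by
    obtain ⟨x, rfl⟩ := proj_surjective z
    rw [← proj_smul, mul_smul, proj_smul, proj_smul]

/-! ### The domain `D'`, its horoballs, and the sets `𝒟_k` -/

/-- The `L'`-horosphere through `(κ, 1, 0)`; for `κ = 0` this is the boundary of `D'` in the
affine patch. -/
def horosphere (κ : ℝ) : Set (EuclideanSpace ℝ (Fin 3)) :=
  MulAction.orbit groupL (!₂[κ, 1, 0] : EuclideanSpace ℝ (Fin 3))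

/-- `D'`: the epigraph (in the direction of `x₁`) of the `L'`-orbit of `(0, 1, 0)`. -/
def domD : Set (EuclideanSpace ℝ (Fin 3)) :=
  {x | ∃ p ∈ horosphere 0, proj p = proj x ∧ p 0 < x 0}

/-- The `L'`-horoball `D'_k`. -/
def horoball (k : ℝ) : Set (EuclideanSpace ℝ (Fin 3)) :=
  ⋃ s : ℝ, ⋃ _ : k < s, horosphere s

/-- The half-plane onto which `D'` and the horospheres project. -/
def halfPlane : Set (EuclideanSpace ℝ (Fin 2)) := {z | 0 < z 0}

/-- A compact fundamental domain `R` for the affine action of `Γ` on the half-plane. -/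
structure IsCompactFundamentalDomain (Γ : Subgroup groupL)
    (R : Set (EuclideanSpace ℝ (Fin 2))) : Prop where
  isCompact : IsCompact R
  subset : R ⊆ halfPlane
  isFundamentalDomain : IsFundamentalDomain Γ R (volume.restrict halfPlane)

/-- The set `𝒟_k`: the part of `D'_k` that lies over `R`. -/
def domainOver (R : Set (EuclideanSpace ℝ (Fin 2))) (k : ℝ) : Set (EuclideanSpace ℝ (Fin 3)) :=
  {x | proj x ∈ R} ∩ horoball k

lemma exists_groupL (a b : ℝ) : ∃ g : groupL, mat g = matL a b :=
  ⟨⟨⟨matL a b, matL (-a) (-b), by rw [matL_mul]; simp [matL_zero],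
    by rw [matL_mul]; simp [matL_zero]⟩, a, b, rfl⟩, rfl⟩

lemma mem_horosphere {κ : ℝ} {x : EuclideanSpace ℝ (Fin 3)} :
    x ∈ horosphere κ ↔ 0 < x 1 ∧ x 0 = κ + (x 2 ^ 2 / 2 - Real.log (x 1)) := by
  constructor
  · rintro ⟨g, rfl⟩
    obtain ⟨a, b, hg⟩ := g.2
    replace hg : mat g = matL a b := hg
    simp only
    rw [smul_def3 g hg]
    simp [Real.exp_pos]
  · rintro ⟨h1, h0⟩
    obtain ⟨g, hg⟩ := exists_groupL (Real.log (x 1)) (x 2)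
    refine ⟨g, ?_⟩
    simp only
    rw [smul_def3 g hg]
    ext i
    fin_cases i
    · simp [h0]
    · simp [Real.exp_log h1]
    · simp

lemma mem_domD {x : EuclideanSpace ℝ (Fin 3)} :
    x ∈ domD ↔ 0 < x 1 ∧ x 2 ^ 2 / 2 - Real.log (x 1) < x 0 := by
  constructor
  · rintro ⟨p, hp, hpx, h⟩
    have e1 : p 1 = x 1 := congrFun (congrArg (fun z => (z : EuclideanSpace ℝ (Fin 2)).ofLp) hpx) 0
    have e2 : p 2 = x 2 := congrFun (congrArg (fun z => (z : EuclideanSpace ℝ (Fin 2)).ofLp) hpx) 1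
    obtain ⟨q1, q2⟩ := mem_horosphere.1 hp
    rw [e1] at q1
    rw [e1, e2] at q2
    exact ⟨q1, by linarith⟩
  · rintro ⟨h1, h0⟩
    refine ⟨!₂[x 2 ^ 2 / 2 - Real.log (x 1), x 1, x 2], mem_horosphere.2 ?_, ?_, ?_⟩
    · simp [h1]
    · simp [proj]
    · simpa using h0

lemma mem_horoball {k : ℝ} {x : EuclideanSpace ℝ (Fin 3)} :
    x ∈ horoball k ↔ 0 < x 1 ∧ k + (x 2 ^ 2 / 2 - Real.log (x 1)) < x 0 := by
  simp only [horoball, Set.mem_iUnion, mem_horosphere, exists_prop]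
  constructor
  · rintro ⟨s, hs, h1, h0⟩
    exact ⟨h1, by linarith⟩
  · rintro ⟨h1, h0⟩
    exact ⟨x 0 - (x 2 ^ 2 / 2 - Real.log (x 1)), by linarith, h1, by ring⟩

lemma domD_isProperlyConvex : IsProperlyConvex domD where
  isOpen := by
    rw [isOpen_iff_mem_nhds]
    intro x hx
    obtain ⟨h1, h0⟩ := mem_domD.1 hx
    have c : ∀ i : Fin 3, ContinuousAt (fun y : EuclideanSpace ℝ (Fin 3) => y i) x := fun i => by
      fun_prop
    have e1 := (c 1).eventually (lt_mem_nhds h1)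
    have cF : ContinuousAt
        (fun y : EuclideanSpace ℝ (Fin 3) => y 2 ^ 2 / 2 - Real.log (y 1)) x :=
      (((c 2).pow 2).div_const 2).sub ((c 1).log h1.ne')
    have e0 := cF.eventually_lt (c 0) h0
    filter_upwards [e1, e0] with y hy1 hy0 using mem_domD.2 ⟨hy1, hy0⟩
  convex := by
    intro x hx y hy a b ha hb hab
    obtain ⟨hx1, hx0⟩ := mem_domD.1 hx
    obtain ⟨hy1, hy0⟩ := mem_domD.1 hy
    have hl := (strictConcaveOn_log_Ioi.concaveOn).2 (Set.mem_Ioi.2 hx1) (Set.mem_Ioi.2 hy1)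
      ha hb hab
    have hpos := (convex_Ioi (0 : ℝ)) (Set.mem_Ioi.2 hx1) (Set.mem_Ioi.2 hy1) ha hb hab
    simp only [smul_eq_mul, Set.mem_Ioi] at hl hpos
    rw [mem_domD]
    simp only [PiLp.add_apply, PiLp.smul_apply, smul_eq_mul]
    refine ⟨hpos, ?_⟩
    have hsq : (a * x 2 + b * y 2) ^ 2 ≤ a * x 2 ^ 2 + b * y 2 ^ 2 := by
      obtain rfl : b = 1 - a := by linarith
      nlinarith [mul_nonneg (mul_nonneg ha hb) (sq_nonneg (x 2 - y 2))]
    have hlin : a * (x 2 ^ 2 / 2 - Real.log (x 1)) + b * (y 2 ^ 2 / 2 - Real.log (y 1))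
        < a * x 0 + b * y 0 := by
      rcases ha.eq_or_lt with rfl | ha
      · obtain rfl : b = 1 := by linarith
        linarith
      · nlinarith
    linarith
  no_line := by
    intro x v hv
    by_contra! hall
    have H : ∀ t : ℝ, 0 < x 1 + t * v 1 ∧
        (x 2 + t * v 2) ^ 2 / 2 - Real.log (x 1 + t * v 1) < x 0 + t * v 0 := fun t => by
      simpa using mem_domD.1 (hall t)
    have v1 : v 1 = 0 := by
      by_contra h
      have := (H (-(x 1) / v 1)).1
      field_simp at this
      linarith
    simp only [v1, mul_zero, add_zero] at H
    have v2 : v 2 = 0 := by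
      by_contra h
      have hp := sq_pos_of_ne_zero h
      have A : ∀ t : ℝ, (x 2 + t * v 2) ^ 2 / 2 - Real.log (x 1) < x 0 + t * v 0 :=
        fun t => (H t).2
      have B : ∀ t : ℝ, t ^ 2 * v 2 ^ 2 / 2 < x 0 + Real.log (x 1) - x 2 ^ 2 / 2 := fun t => by
        nlinarith [A t, A (-t)]
      have C := B (|x 0 + Real.log (x 1) - x 2 ^ 2 / 2| * 2 / v 2 ^ 2 + 1)
      have D := le_abs_self (x 0 + Real.log (x 1) - x 2 ^ 2 / 2)
      have E := abs_nonneg (x 0 + Real.log (x 1) - x 2 ^ 2 / 2)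
      set m := |x 0 + Real.log (x 1) - x 2 ^ 2 / 2|
      have F : (m * 2 / v 2 ^ 2) * v 2 ^ 2 = m * 2 := by field_simp
      have G : 0 ≤ m * 2 / v 2 ^ 2 := by positivity
      nlinarith
    simp only [v2, mul_zero, add_zero] at H
    have v0 : v 0 = 0 := by
      by_contra h
      have := (H ((x 2 ^ 2 / 2 - Real.log (x 1) - x 0) / v 0)).2
      rw [div_mul_cancel₀ _ h] at this
      linarith
    apply hv
    ext i
    fin_cases i
    · exact v0
    · exact v1
    · exact v2

end CuspVolume

end

noncomputable section

namespace CuspVolume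

open Topology Set
open scoped NNReal Pointwise

variable {Γ : Subgroup groupL}

/-! In the coordinates `(a, b)` the group is the additive plane, and it acts simply transitively on
the half-plane through the orbit map `expMap` of the point `(1, 0)`. A lattice `Γ` becomes a
discrete subgroup of the plane. It spans the plane (`span_coordLattice`), since otherwise a linear
functional that kills it would push the invariant measure of the quotient to a finite nonzero
translation invariant measure on `ℝ`. The closed fundamental parallelogram is then compact, and its
image under `expMap` serves as `R`. The projection to the half-plane is equivariant and horoballs
are invariant, so the part of a horoball over `R` is again a fundamental domain.

For the volume, let `t` be the height of a point over the graph of `x₃² / 2 - log x₂`, with the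
projection in a fixed compact set. Moving `x₃` by a small multiple of `√t`, `x₂` by a small constant
and `x₁` by a small multiple of `t` changes the height by less than `t`, so a box of these sides
around the point stays in the domain (`exists_box`). Hence unit balls have volume at least of order
`t ^ (3/2)`, and the Busemann density is at most of order `t ^ (-3/2)`, which is integrable at
infinity. For Hausdorff measure this says that the chart `(t p₀, p₁, √t p₂)` is Lipschitz into the
Hilbert metric with a constant independent of `t` (`exists_lipschitzOnWith`).

An arbitrary fundamental domain is compared with the one over `R`: Busemann volume is invariant and
absolutely continuous with respect to Lebesgue measure, so the choice of fundamental domain does not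
matter (`busemannVolume_le_of_isFundamentalDomain`). -/

/-! ### Coordinates on the group -/

/-- The element of `L'` with parameters `a` and `b`. -/
def elemL (a b : ℝ) : groupL :=
  ⟨⟨matL a b, matL (-a) (-b), by rw [matL_mul]; simp [matL_zero],
    by rw [matL_mul]; simp [matL_zero]⟩, a, b, rfl⟩

lemma mat_elemL (a b : ℝ) : mat (elemL a b) = matL a b := rfl

lemma exists_eq_elemL (g : groupL) : ∃ a b : ℝ, g = elemL a b := by
  obtain ⟨a, b, hg⟩ := g.2
  exact ⟨a, b, Subtype.ext (Units.ext hg)⟩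

lemma elemL_mul (a b c d : ℝ) : elemL a b * elemL c d = elemL (a + c) (b + d) :=
  Subtype.ext (Units.ext (matL_mul a b c d))

lemma elemL_zero : elemL 0 0 = 1 := Subtype.ext (Units.ext matL_zero)

lemma continuous_matL : Continuous fun z : EuclideanSpace ℝ (Fin 2) => matL (z 0) (z 1) := by
  refine continuous_matrix fun i j => ?_
  fin_cases i <;> fin_cases j <;> simp [matL] <;> fun_prop

lemma continuous_elemL :
    Continuous fun z : EuclideanSpace ℝ (Fin 2) => elemL (z 0) (z 1) := by
  refine Continuous.subtype_mk (Units.continuous_iff.2 ⟨continuous_matL, ?_⟩) _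
  have h : Continuous fun z : EuclideanSpace ℝ (Fin 2) => matL ((-z) 0) ((-z) 1) :=
    continuous_matL.comp continuous_neg
  exact h

/-- The coordinates `(a, b)` of an element of `L'`. -/
def coords (g : groupL) : EuclideanSpace ℝ (Fin 2) := !₂[Real.log (mat g 1 1), mat g 2 3]

lemma coords_elemL (a b : ℝ) : coords (elemL a b) = !₂[a, b] := by
  simp [coords, mat_elemL, matL]

lemma elemL_coords (g : groupL) : elemL (coords g 0) (coords g 1) = g := by
  obtain ⟨a, b, rfl⟩ := exists_eq_elemL g
  simp [coords_elemL]

lemma coords_injective : Function.Injective coords := fun g h e => by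
  rw [← elemL_coords g, ← elemL_coords h, e]

lemma coords_mul (g h : groupL) : coords (g * h) = coords g + coords h := by
  obtain ⟨a, b, rfl⟩ := exists_eq_elemL g
  obtain ⟨c, d, rfl⟩ := exists_eq_elemL h
  rw [elemL_mul, coords_elemL, coords_elemL, coords_elemL]
  ext i
  fin_cases i <;> simp

lemma coords_one : coords 1 = 0 := by
  rw [← elemL_zero, coords_elemL]
  ext i
  fin_cases i <;> simp

lemma coords_inv (g : groupL) : coords g⁻¹ = -coords g := by
  rw [eq_neg_iff_add_eq_zero, ← coords_mul, inv_mul_cancel, coords_one]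

lemma coords_surjective : Function.Surjective coords := fun z =>
  ⟨elemL (z 0) (z 1), by
    rw [coords_elemL]
    ext i
    fin_cases i <;> simp⟩

lemma continuous_coords : Continuous coords := by
  have hm : Continuous mat := Units.continuous_val.comp continuous_subtype_val
  have h11 : ∀ g, mat g 1 1 ≠ 0 := fun g => by
    obtain ⟨a, b, rfl⟩ := exists_eq_elemL g
    simp [mat_elemL, matL]
  refine (PiLp.continuous_toLp 2 _).comp (continuous_pi fun i => ?_)
  fin_cases i
  · exact (hm.matrix_elem 1 1).log h11
  · exact hm.matrix_elem 2 3

/-! ### Lattices in `L'` correspond to lattices in the plane -/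

/-- The coordinates of the elements of a subgroup of `L'`. -/
def coordLattice (Γ : Subgroup groupL) : Submodule ℤ (EuclideanSpace ℝ (Fin 2)) :=
  AddSubgroup.toIntSubmodule
    { carrier := coords '' Γ
      add_mem' := by
        rintro _ _ ⟨g, hg, rfl⟩ ⟨h, hh, rfl⟩
        exact ⟨g * h, Γ.mul_mem hg hh, coords_mul g h⟩
      zero_mem' := ⟨1, Γ.one_mem, coords_one⟩
      neg_mem' := by
        rintro _ ⟨g, hg, rfl⟩
        exact ⟨g⁻¹, Γ.inv_mem hg, coords_inv g⟩ }

lemma mem_coordLattice {z : EuclideanSpace ℝ (Fin 2)} :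
    z ∈ coordLattice Γ ↔ ∃ g ∈ Γ, coords g = z := Iff.rfl

lemma coords_mem_coordLattice (g : Γ) : coords g ∈ coordLattice Γ := ⟨g, g.2, rfl⟩

lemma elemL_mem_of_mem_coordLattice {z : EuclideanSpace ℝ (Fin 2)} (hz : z ∈ coordLattice Γ) :
    elemL (z 0) (z 1) ∈ Γ := by
  obtain ⟨g, hg, rfl⟩ := mem_coordLattice.1 hz
  rwa [elemL_coords]

/-- The inverse of the coordinate map is continuous and injective from the coordinate lattice into
the discrete space `Γ`, which forces its source to be discrete. -/
lemma discreteTopology_coordLattice (h : DiscreteTopology Γ) :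
    DiscreteTopology (coordLattice Γ) := by
  have hc : Continuous fun z : coordLattice Γ =>
      (⟨elemL (z.1 0) (z.1 1), elemL_mem_of_mem_coordLattice z.2⟩ : Γ) :=
    (continuous_elemL.comp continuous_subtype_val).subtype_mk _
  refine DiscreteTopology.of_continuous_injective hc fun z w e => ?_
  have e' := congrArg (fun g : Γ => coords g.1) e
  simp only [coords_elemL] at e'
  ext i
  have := congrFun (congrArg WithLp.ofLp e') i
  fin_cases i <;> simpa using this

lemma countable_of_discreteTopology (h : DiscreteTopology Γ) : Countable Γ := by
  have := discreteTopology_coordLattice h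
  have : Countable (coordLattice Γ) := TopologicalSpace.separableSpace_iff_countable.1 inferInstance
  refine Function.Injective.countable
    (f := fun g : Γ => (⟨coords g, coords_mem_coordLattice g⟩ : coordLattice Γ)) ?_
  intro g g' e
  exact Subtype.ext (coords_injective (Subtype.ext_iff.1 e))

/-- A finite translation invariant measure on the real line vanishes. -/
lemma eq_zero_of_isAddLeftInvariant (μ : Measure ℝ) [IsFiniteMeasure μ]
    [μ.IsAddLeftInvariant] : μ = 0 := by
  by_contra h
  have : NeZero μ := ⟨h⟩
  exact (measure_lt_top μ univ).ne (measure_univ_of_isAddLeftInvariant μ)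

/-- This is where finite covolume enters: a functional `f` vanishing on the lattice descends to `F`
on the quotient, and the finite invariant measure pushed forward by `F` must vanish. -/
lemma span_coordLattice (h : IsLatticeIn Γ) :
    Submodule.span ℝ (coordLattice Γ : Set (EuclideanSpace ℝ (Fin 2))) = ⊤ := by
  by_contra hne
  obtain ⟨f, hf, hle⟩ := Submodule.exists_le_ker_of_lt_top _ (lt_top_iff_ne_top.2 hne)
  have hfs : Function.Surjective f := LinearMap.surjective hf
  have hfc : Continuous f := f.continuous_of_finiteDimensional
  have hΓ : ∀ g ∈ Γ, f (coords g) = 0 := fun g hg =>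
    hle (Submodule.subset_span (mem_coordLattice.2 ⟨g, hg, rfl⟩))
  obtain ⟨ν, hν0, hνfin, hνinv⟩ := h.finite_covolume
  let : MeasurableSpace (groupL ⧸ Γ) := borel _
  have : BorelSpace (groupL ⧸ Γ) := ⟨rfl⟩
  let F : groupL ⧸ Γ → ℝ := Quotient.lift (fun g => f (coords g)) fun g g' e => by
    have e1 : g⁻¹ * g' ∈ Γ := QuotientGroup.leftRel_apply.1 e
    have := hΓ _ e1
    rw [coords_mul, coords_inv, map_add, map_neg] at this
    linarith
  have hFmk : ∀ g : groupL, F (QuotientGroup.mk g) = f (coords g) := fun g => rfl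
  have hFc : Continuous F := (hfc.comp continuous_coords).quotient_lift _
  have hF : ∀ (g : groupL) (q : groupL ⧸ Γ), F (g • q) = f (coords g) + F q := fun g q => by
    induction q using QuotientGroup.induction_on with
    | H x =>
      change F (QuotientGroup.mk (g * x)) = _
      rw [hFmk, hFmk, coords_mul, map_add]
  have : IsFiniteMeasure ν := ⟨hνfin⟩
  -- Each real number is `f (coords g)` for some `g`, so every translation of the line is induced by
  -- a group element acting on the quotient.
  have : (ν.map F).IsAddLeftInvariant := ⟨fun r => by
    obtain ⟨z, rfl⟩ := hfs r
    obtain ⟨g, rfl⟩ := coords_surjective z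
    ext S hS
    rw [Measure.map_apply (measurable_const_add _) hS,
      Measure.map_apply hFc.measurable (measurable_const_add _ hS),
      Measure.map_apply hFc.measurable hS, ← hνinv g _ (hFc.measurable hS)]
    congr 1
    ext q
    simp [hF]⟩
  have h0 := eq_zero_of_isAddLeftInvariant (ν.map F)
  exact hν0 ((Measure.map_eq_zero_iff hFc.measurable.aemeasurable).1 h0)

/-! ### A compact fundamental domain in the half-plane -/

/-- The map `(a, b) ↦ (e ^ a, b)` from the plane to the half-plane, that is, the orbit map
of the point `(1, 0)`. -/
def expMap (z : EuclideanSpace ℝ (Fin 2)) : EuclideanSpace ℝ (Fin 2) := !₂[Real.exp (z 0), z 1]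

lemma differentiable_expMap : Differentiable ℝ expMap := by
  rw [differentiable_euclidean]
  intro i
  fin_cases i
  · simp only [expMap]
    exact Differentiable.exp (f := fun z : EuclideanSpace ℝ (Fin 2) => z 0) (by fun_prop)
  · change Differentiable ℝ fun z : EuclideanSpace ℝ (Fin 2) => z 1
    fun_prop

lemma expMap_mem_halfPlane (z : EuclideanSpace ℝ (Fin 2)) : expMap z ∈ halfPlane := by
  simp [expMap, halfPlane, Real.exp_pos]

lemma exists_expMap_eq {w : EuclideanSpace ℝ (Fin 2)} (hw : w ∈ halfPlane) :
    ∃ z, expMap z = w := by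
  refine ⟨!₂[Real.log (w 0), w 1], ?_⟩
  ext i
  fin_cases i
  · simpa [expMap] using Real.exp_log hw
  · simp [expMap]

lemma expMap_injective : Function.Injective expMap := fun z w e => by
  have h0 := congrFun (congrArg WithLp.ofLp e) 0
  have h1 := congrFun (congrArg WithLp.ofLp e) 1
  ext i
  fin_cases i
  · simpa [expMap] using h0
  · simpa [expMap] using h1

lemma smul_expMap (g : groupL) (z : EuclideanSpace ℝ (Fin 2)) :
    g • expMap z = expMap (coords g + z) := by
  obtain ⟨a, b, rfl⟩ := exists_eq_elemL g
  rw [smul_def2 _ (mat_elemL a b), coords_elemL]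
  ext i
  fin_cases i
  · simp [expMap, Real.exp_add]
  · simp [expMap, add_comm]

/-- The half-open parallelepiped is convex, and the frontier of a convex set is null. Passing to the
closure buys compactness at no cost in measure. -/
lemma closure_fundamentalDomain_ae_eq {ι E : Type*} [Finite ι] [NormedAddCommGroup E]
    [NormedSpace ℝ E] [MeasurableSpace E] [BorelSpace E] [FiniteDimensional ℝ E]
    (b : Module.Basis ι ℝ E) (μ : Measure E) [μ.IsAddHaarMeasure] :
    closure (ZSpan.fundamentalDomain b) =ᵐ[μ] ZSpan.fundamentalDomain b := by
  have hconv : Convex ℝ (ZSpan.fundamentalDomain b) := by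
    intro x hx y hy s t hs ht hst i
    have := (convex_Ico (𝕜 := ℝ) (0 : ℝ) 1) (hx i) (hy i) hs ht hst
    simpa using this
  refine (Filter.eventuallyLE_antisymm_iff.2 ⟨?_, ?_⟩)
  · rw [ae_le_set]
    refine measure_mono_null ?_ (hconv.addHaar_frontier μ)
    exact fun x hx => ⟨hx.1, fun hi => hx.2 (interior_subset hi)⟩
  · exact subset_closure.eventuallyLE

theorem exists_isCompactFundamentalDomain (h : IsLatticeIn Γ) :
    ∃ R, IsCompactFundamentalDomain Γ R := by
  have := discreteTopology_coordLattice h.discrete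
  have : IsZLattice ℝ (coordLattice Γ) := ⟨span_coordLattice h⟩
  have : Module.Finite ℤ (coordLattice Γ) := ZLattice.module_finite ℝ _
  have : Module.Free ℤ (coordLattice Γ) := ZLattice.module_free ℝ _
  let b := Module.Free.chooseBasis ℤ (coordLattice Γ)
  let P := ZSpan.fundamentalDomain (b.ofZLatticeBasis ℝ)
  have hP : IsAddFundamentalDomain (coordLattice Γ) P := ZLattice.isAddFundamentalDomain b volume
  have hPc : closure P =ᵐ[volume] P := closure_fundamentalDomain_ae_eq _ _
  have hcomp : IsCompact (closure P) := (ZSpan.fundamentalDomain_isBounded _).isCompact_closure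
  have hR : IsCompact (expMap '' closure P) := hcomp.image differentiable_expMap.continuous
  refine ⟨expMap '' closure P, hR, ?_, ⟨hR.measurableSet.nullMeasurableSet, ?_, ?_⟩⟩
  · rintro _ ⟨z, -, rfl⟩
    exact expMap_mem_halfPlane z
  · have hU : MeasurableSet halfPlane :=
      measurableSet_lt measurable_const (by fun_prop)
    filter_upwards [ae_restrict_mem hU] with w hw
    obtain ⟨z, rfl⟩ := exists_expMap_eq hw
    obtain ⟨v, hv, -⟩ := ZSpan.exist_unique_vadd_mem_fundamentalDomain (b.ofZLatticeBasis ℝ) z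
    have hv' : (v : EuclideanSpace ℝ (Fin 2)) ∈ coordLattice Γ := by
      exact (b.ofZLatticeBasis_span ℝ).le v.2
    obtain ⟨g, hg, e⟩ := mem_coordLattice.1 hv'
    refine ⟨⟨g, hg⟩, (v : EuclideanSpace ℝ (Fin 2)) + z, subset_closure hv, ?_⟩
    rw [← e, ← smul_expMap]
    rfl
  · intro g g' hgg
    let v : coordLattice Γ := ⟨coords g, coords_mem_coordLattice g⟩
    let v' : coordLattice Γ := ⟨coords g', coords_mem_coordLattice g'⟩
    have hvv : v ≠ v' := fun e =>
      hgg (Subtype.ext (coords_injective (Subtype.ext_iff.1 e)))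
    -- Translates of the closed parallelogram overlap in a null set because those of the half-open
    -- one do; `expMap`, being differentiable, carries this null set to a null set.
    have htr : ∀ u : coordLattice Γ, (u +ᵥ closure P : Set _) =ᵐ[volume] (u +ᵥ P : Set _) :=
      fun u => (vadd_set_ae_eq (u : EuclideanSpace ℝ (Fin 2))).2 hPc
    have hnull : volume ((v +ᵥ closure P) ∩ (v' +ᵥ closure P) : Set _) = 0 := by
      rw [measure_congr ((htr v).inter (htr v'))]
      exact hP.aedisjoint hvv
    have himg := addHaar_image_eq_zero_of_differentiableOn_of_addHaar_eq_zero volume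
      (differentiable_expMap.differentiableOn
        (s := (v +ᵥ closure P) ∩ (v' +ᵥ closure P))) hnull
    refine Measure.restrict_apply_le _ _ |>.trans ?_ |>.antisymm zero_le
    refine (measure_mono ?_).trans himg.le
    rintro _ ⟨⟨_, ⟨z, hz, rfl⟩, rfl⟩, ⟨_, ⟨z', hz', rfl⟩, e⟩⟩
    have e1 : expMap (coords g' + z') = expMap (coords g + z) := by
      rw [← smul_expMap, ← smul_expMap]
      exact e
    refine ⟨coords g + z, ⟨⟨z, hz, rfl⟩, ⟨z', hz', expMap_injective e1⟩⟩, ?_⟩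
    rw [← smul_expMap]
    rfl

/-! ### The part of a horoball over a fundamental domain -/

/-- A surjective linear map pushes Lebesgue measure to a multiple of Lebesgue measure. The fibres
are lines, so the factor is infinite, but only the transfer of null sets is needed. -/
lemma proj_quasiMeasurePreserving : Measure.QuasiMeasurePreserving proj := by
  let L : EuclideanSpace ℝ (Fin 3) →ₗ[ℝ] EuclideanSpace ℝ (Fin 2) :=
    { toFun := proj
      map_add' := fun x y => by
        ext i
        fin_cases i <;> simp [proj]
      map_smul' := fun r x => by
        ext i
        fin_cases i <;> simp [proj] }
  have hL : Continuous L := L.continuous_of_finiteDimensional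
  obtain ⟨c, -, hc⟩ :=
    L.exists_map_addHaar_eq_smul_addHaar volume volume proj_surjective
  refine ⟨hL.measurable, ?_⟩
  change Measure.map L volume ≪ volume
  rw [hc]
  exact Measure.smul_absolutelyContinuous

lemma continuous_proj : Continuous proj := by
  refine (PiLp.continuous_toLp 2 _).comp (continuous_pi fun i => ?_)
  fin_cases i <;> simp <;> fun_prop

lemma measurableSet_halfPlane : MeasurableSet halfPlane :=
  measurableSet_lt measurable_const (by fun_prop)

lemma measurableSet_horoball (k : ℝ) : MeasurableSet (horoball k) := by
  have : horoball k = {x | 0 < x 1} ∩ {x | k + (x 2 ^ 2 / 2 - Real.log (x 1)) < x 0} := by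
    ext x
    exact mem_horoball
  rw [this]
  exact (measurableSet_lt (by fun_prop) (by fun_prop)).inter
    (measurableSet_lt (by fun_prop) (by fun_prop))

/-- The height `x 0 - (x 2 ^ 2 / 2 - log (x 1))` is invariant under the group: the terms in `a` and
`b` cancel. -/
lemma smul_mem_horoball (g : groupL) {k : ℝ} {x : EuclideanSpace ℝ (Fin 3)} :
    g • x ∈ horoball k ↔ x ∈ horoball k := by
  obtain ⟨a, b, rfl⟩ := exists_eq_elemL g
  rw [mem_horoball, mem_horoball, smul_def3 _ (mat_elemL a b)]
  simp only [Matrix.cons_val_zero, Matrix.cons_val_one, Matrix.cons_val]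
  rw [mul_pos_iff_of_pos_left (Real.exp_pos a)]
  refine and_congr_right fun h => ?_
  rw [Real.log_mul (Real.exp_pos a).ne' h.ne', Real.log_exp]
  constructor <;> intro <;> nlinarith

lemma proj_mem_halfPlane_of_mem_horoball {k : ℝ} {x : EuclideanSpace ℝ (Fin 3)}
    (hx : x ∈ horoball k) : proj x ∈ halfPlane := by
  simpa [halfPlane, proj] using (mem_horoball.1 hx).1

lemma measurableSet_domainOver {R : Set (EuclideanSpace ℝ (Fin 2))} (hR : MeasurableSet R)
    (k : ℝ) : MeasurableSet (domainOver R k) :=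
  (continuous_proj.measurable hR).inter (measurableSet_horoball k)

lemma smul_mem_halfPlane (g : groupL) {z : EuclideanSpace ℝ (Fin 2)} (hz : z ∈ halfPlane) :
    g • z ∈ halfPlane := by
  obtain ⟨w, rfl⟩ := exists_expMap_eq hz
  rw [smul_expMap]
  exact expMap_mem_halfPlane _

theorem isFundamentalDomain_domainOver {R : Set (EuclideanSpace ℝ (Fin 2))}
    (hR : IsCompactFundamentalDomain Γ R) (k : ℝ) :
    IsFundamentalDomain Γ (domainOver R k) (volume.restrict (horoball k)) where
  nullMeasurableSet :=
    (measurableSet_domainOver hR.isCompact.measurableSet k).nullMeasurableSet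
  ae_covers := by
    have h := hR.isFundamentalDomain.ae_covers
    rw [ae_restrict_iff' measurableSet_halfPlane] at h
    rw [ae_restrict_iff' (measurableSet_horoball k)]
    filter_upwards [proj_quasiMeasurePreserving.ae h] with x hx hxk
    obtain ⟨g, hg⟩ := hx (proj_mem_halfPlane_of_mem_horoball hxk)
    refine ⟨g, ?_, (smul_mem_horoball g.1).2 hxk⟩
    change proj (g.1 • x) ∈ R
    rw [proj_smul]
    exact hg
  aedisjoint := by
    intro g g' hgg
    have h := hR.isFundamentalDomain.aedisjoint hgg
    -- The overlap lies in the half-plane, so it is null for unrestricted Lebesgue measure, as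
    -- pulling back along `proj` requires.
    have hsub : (g • R ∩ g' • R : Set _) ⊆ halfPlane := by
      rintro _ ⟨⟨z, hz, rfl⟩, -⟩
      exact smul_mem_halfPlane g.1 (hR.subset hz)
    have h' : volume (g • R ∩ g' • R : Set _) = 0 := by
      rw [← Measure.restrict_eq_self volume hsub]
      exact h
    refine Measure.restrict_apply_le _ _ |>.trans ?_ |>.antisymm zero_le
    refine (measure_mono ?_).trans (proj_quasiMeasurePreserving.preimage_null h').le
    rintro _ ⟨⟨x, hx, rfl⟩, ⟨y, hy, e⟩⟩
    refine ⟨⟨proj x, hx.1, (proj_smul g.1 x).symm⟩, ⟨proj y, hy.1, ?_⟩⟩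
    rw [← e]
    exact (proj_smul g'.1 y).symm

/-! ### Boxes inside the domain -/

/-- The function whose epigraph is the domain. -/
def graphFun (x : EuclideanSpace ℝ (Fin 3)) : ℝ := x 2 ^ 2 / 2 - Real.log (x 1)

/-- Around every point of the domain at height `t ≥ κ` over the boundary and over a bounded part of
the half-plane there is a box with side lengths of the order of `t`, `1` and `√t`. -/
lemma exists_box {B κ : ℝ} (hB : 1 ≤ B) (hκ : 0 < κ) :
    ∃ c : ℝ, 0 < c ∧ ∀ (x v : EuclideanSpace ℝ (Fin 3)) (t : ℝ), B⁻¹ ≤ x 1 → |x 2| ≤ B →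
      κ ≤ t → graphFun x + t ≤ x 0 → |v 0| ≤ c * t → |v 1| ≤ c → |v 2| ≤ c * √t →
      x + v ∈ domD := by
  have hB0 : 0 < B := by linarith
  have hsκ : 0 < √κ := Real.sqrt_pos.2 hκ
  -- The four bounds on `c` serve in turn to make `c * t` and `c ^ 2 * t` small, to keep `x 1 + v 1`
  -- above `B⁻¹ / 2`, to give `B * c * √t ≤ t / 4` for the cross term `x 2 * v 2`, and to give `2 *
  -- B * c ≤ t / 4` for the change of the logarithm. The total loss of height is at most `25 / 32 *
  -- t`.
  refine ⟨min (1 / 4) (min (B⁻¹ / 2) (min (√κ / (4 * B)) (κ / (8 * B)))), by positivity, ?_⟩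
  intro x v t h1 h2 ht hx hv0 hv1 hv2
  set c := min (1 / 4) (min (B⁻¹ / 2) (min (√κ / (4 * B)) (κ / (8 * B)))) with hc
  have c0 : 0 < c := by positivity
  have c1 : c ≤ 1 / 4 := min_le_left _ _
  have c2 : c ≤ B⁻¹ / 2 := (min_le_right _ _).trans (min_le_left _ _)
  have c3 : c ≤ √κ / (4 * B) :=
    (min_le_right _ _).trans ((min_le_right _ _).trans (min_le_left _ _))
  have c4 : c ≤ κ / (8 * B) :=
    (min_le_right _ _).trans ((min_le_right _ _).trans (min_le_right _ _))
  clear_value c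
  rw [le_div_iff₀ (by positivity)] at c3 c4
  have ht0 : 0 < t := by linarith
  have hst : √t * √t = t := Real.mul_self_sqrt ht0.le
  have hst0 : 0 < √t := Real.sqrt_pos.2 ht0
  have hκt : √κ ≤ √t := Real.sqrt_le_sqrt ht
  have hBi : 0 < B⁻¹ := by positivity
  have hBB : B * B⁻¹ = 1 := mul_inv_cancel₀ hB0.ne'
  obtain ⟨v0, -⟩ := abs_le.1 hv0
  obtain ⟨v1, -⟩ := abs_le.1 hv1
  have hx1 : 0 < x 1 := by linarith
  have hxv : B⁻¹ / 2 ≤ x 1 + v 1 := by linarith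
  have hxv0 : 0 < x 1 + v 1 := by linarith
  have hlog : Real.log (x 1) - Real.log (x 1 + v 1) ≤ 2 * B * c := by
    rw [← Real.log_div hx1.ne' hxv0.ne']
    refine (Real.log_le_sub_one_of_pos (by positivity)).trans ?_
    rw [div_sub_one hxv0.ne', div_le_iff₀ hxv0]
    nlinarith [mul_le_mul_of_nonneg_left hxv (by positivity : 0 ≤ 2 * B * c)]
  have hmul : x 2 * v 2 ≤ B * (c * √t) := by
    refine (le_abs_self _).trans ?_
    rw [abs_mul]
    exact mul_le_mul h2 hv2 (abs_nonneg _) hB0.le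
  have hlin : B * (c * √t) ≤ t / 4 := by nlinarith
  have hsq : v 2 ^ 2 ≤ c ^ 2 * t := by
    calc v 2 ^ 2 = |v 2| ^ 2 := (sq_abs _).symm
      _ ≤ (c * √t) ^ 2 := pow_le_pow_left₀ (abs_nonneg _) hv2 2
      _ = c ^ 2 * t := by rw [mul_pow, sq (√t), hst]
  have hsq' : c ^ 2 * t ≤ t / 16 := by
    have : c ^ 2 ≤ 1 / 16 := by nlinarith
    nlinarith
  have hct : c * t ≤ t / 4 := by nlinarith
  rw [mem_domD]
  unfold graphFun at hx
  simp only [PiLp.add_apply]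
  refine ⟨hxv0, ?_⟩
  nlinarith

lemma exitRate_le_of_add_mem {n : ℕ} {Ω : Set (EuclideanSpace ℝ (Fin n))}
    {x v : EuclideanSpace ℝ (Fin n)} {r : ℝ} (hr : 0 < r) (h : x + r⁻¹ • v ∈ Ω) :
    exitRate Ω x v ≤ r :=
  gauge_le_of_mem hr.le ⟨r⁻¹ • v, h, smul_inv_smul₀ hr.ne' v⟩

/-- The exit rate in terms of the coordinates of a vector. -/
lemma exists_exitRate_le {B κ : ℝ} (hB : 1 ≤ B) (hκ : 0 < κ) :
    ∃ c : ℝ, 0 < c ∧ ∀ (x v : EuclideanSpace ℝ (Fin 3)) (t r : ℝ), B⁻¹ ≤ x 1 → |x 2| ≤ B →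
      κ ≤ t → graphFun x + t ≤ x 0 → 0 < r →
      |v 0| ≤ r * (c * t) → |v 1| ≤ r * c → |v 2| ≤ r * (c * √t) →
      exitRate domD x v ≤ r := by
  obtain ⟨c, hc, h⟩ := exists_box hB hκ
  refine ⟨c, hc, fun x v t r h1 h2 ht hx hr hv0 hv1 hv2 => exitRate_le_of_add_mem hr ?_⟩
  have key : ∀ {a b : ℝ}, |a| ≤ r * b → |r⁻¹ * a| ≤ b := fun {a b} hab => by
    rw [abs_mul, abs_of_pos (inv_pos.2 hr), inv_mul_le_iff₀ hr]
    exact hab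
  exact h x _ t h1 h2 ht hx (key hv0) (key hv1) (key hv2)

/-- A compact subset of the half-plane lies in a box. -/
lemma exists_bound_of_isCompact {R : Set (EuclideanSpace ℝ (Fin 2))} (hR : IsCompact R)
    (hsub : R ⊆ halfPlane) :
    ∃ B : ℝ, 1 ≤ B ∧ ∀ z ∈ R, B⁻¹ ≤ z 0 ∧ z 0 ≤ B ∧ |z 1| ≤ B := by
  obtain ⟨B₀, h₀⟩ := hR.exists_bound_of_continuousOn (f := fun z => (z 0)⁻¹)
    (ContinuousOn.inv₀ (by fun_prop) fun z hz => (show 0 < z 0 from hsub hz).ne')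
  obtain ⟨B₁, h₁⟩ := hR.exists_bound_of_continuousOn (f := fun z => z 0) (by fun_prop)
  obtain ⟨B₂, h₂⟩ := hR.exists_bound_of_continuousOn (f := fun z => z 1) (by fun_prop)
  refine ⟨max 1 (max B₀ (max B₁ B₂)), le_max_left _ _, fun z hz => ⟨?_, ?_, ?_⟩⟩
  · have hz0 : 0 < z 0 := hsub hz
    refine inv_le_of_inv_le₀ hz0 ?_
    exact (le_abs_self _).trans ((h₀ z hz).trans (by simp))
  · exact (le_abs_self _).trans ((h₁ z hz).trans (by simp))
  · exact (h₂ z hz).trans (by simp)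

lemma volume_setOf_abs_le (a : Fin 3 → ℝ) :
    volume {v : EuclideanSpace ℝ (Fin 3) | ∀ i, |v i| ≤ a i} =
      ∏ i, ENNReal.ofReal (2 * a i) := by
  have h : {v : EuclideanSpace ℝ (Fin 3) | ∀ i, |v i| ≤ a i} =
      WithLp.ofLp ⁻¹' (Icc (-a) a) := by
    ext v
    simp only [mem_ofPred_eq, mem_preimage, mem_Icc, Pi.le_def, abs_le, forall_and]
    rfl
  rw [h, (PiLp.volume_preserving_ofLp (Fin 3)).measure_preimage
    measurableSet_Icc.nullMeasurableSet, Real.volume_Icc_pi]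
  simp [two_mul]

theorem exists_lt_volume_hilbertUnitBall {R : Set (EuclideanSpace ℝ (Fin 2))} (hR : IsCompact R)
    (hsub : R ⊆ halfPlane) :
    ∃ C : ℝ, 0 < C ∧ ∃ N : ℝ, ∀ k : ℝ, 0 < k → ∀ x ∈ domainOver R k, N < x 0 →
      ENNReal.ofReal (C * x 0 ^ (3 / 2 : ℝ)) < volume (hilbertUnitBall domD x) := by
  obtain ⟨B, hB, hRB⟩ := exists_bound_of_isCompact hR hsub
  obtain ⟨c, hc, hexit⟩ := exists_exitRate_le hB one_pos
  -- Above this `N` the graph function, at most `B ^ 2 / 2 + B`, is below `x 0 / 2`, so the point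
  -- has height at least `x 0 / 2 ≥ 1`. The box used below has volume `2 * c ^ 3 / 27 * x 0 ^
  -- (3/2)`, which leaves a factor `2` for the strict inequality.
  refine ⟨c ^ 3 / 27, by positivity, B ^ 2 + 2 * B + 2, fun k hk x hx hN => ?_⟩
  obtain ⟨h1, -, h2⟩ := hRB _ hx.1
  replace h1 : B⁻¹ ≤ x 1 := by simpa [proj] using h1
  replace h2 : |x 2| ≤ B := by simpa [proj] using h2
  have hB0 : 0 < B := by linarith
  have hx0 : 2 < x 0 := by nlinarith
  have hlog : -B ≤ Real.log (x 1) := by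
    refine le_trans ?_ (Real.log_le_log (by positivity) h1)
    rw [Real.log_inv]
    linarith [Real.log_le_sub_one_of_pos hB0]
  have hx2 : x 2 ^ 2 ≤ B ^ 2 := by
    rw [← sq_abs]
    exact pow_le_pow_left₀ (abs_nonneg _) h2 2
  have hgraph : graphFun x + x 0 / 2 ≤ x 0 := by
    unfold graphFun
    linarith
  have hs : √(x 0) / 2 ≤ √(x 0 / 2) := by
    refine Real.le_sqrt_of_sq_le ?_
    rw [div_pow, Real.sq_sqrt (by linarith)]
    linarith
  have hs0 : 0 < √(x 0) := Real.sqrt_pos.2 (by linarith)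
  -- These half-sides make the exit rates of `v` and `-v` at most `1 / 3` each, so the Hilbert norm
  -- is at most `2 / 3`.
  let a : Fin 3 → ℝ := ![c * x 0 / 6, c / 3, c * √(x 0) / 6]
  have hball : {v : EuclideanSpace ℝ (Fin 3) | ∀ i, |v i| ≤ a i} ⊆ hilbertUnitBall domD x := by
    intro v hv
    have key : ∀ w : EuclideanSpace ℝ (Fin 3), (∀ i, |w i| ≤ a i) →
        exitRate domD x w ≤ 1 / 3 := fun w hw => by
      have w0 := hw 0
      have w1 := hw 1
      have w2 := hw 2
      simp only [a, Matrix.cons_val_zero, Matrix.cons_val_one, Matrix.cons_val] at w0 w1 w2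
      refine hexit x w (x 0 / 2) (1 / 3) h1 h2 (by linarith) hgraph (by norm_num)
        (by linarith) (by linarith) (w2.trans ?_)
      nlinarith
    have e1 := key v hv
    have e2 := key (-v) fun i => by simpa using hv i
    change hilbertNorm domD x v < 1
    unfold hilbertNorm
    linarith
  refine lt_of_lt_of_le ?_ (measure_mono hball)
  rw [volume_setOf_abs_le, Fin.prod_univ_three]
  simp only [a, Matrix.cons_val_zero, Matrix.cons_val_one, Matrix.cons_val]
  rw [← ENNReal.ofReal_mul (by positivity), ← ENNReal.ofReal_mul (by positivity)]
  have hpow : x 0 ^ (3 / 2 : ℝ) = x 0 * √(x 0) := by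
    rw [Real.sqrt_eq_rpow, ← Real.rpow_one_add' (by linarith) (by norm_num)]
    norm_num
  rw [hpow, ENNReal.ofReal_lt_ofReal_iff (by positivity)]
  have : 0 < c ^ 3 * (x 0 * √(x 0)) := by positivity
  nlinarith

/-! ### Upper bounds for the Hilbert distance -/

lemma log_inv_one_sub_le {r s : ℝ} (hr : 0 ≤ r) (hrs : r ≤ s) (hs : s ≤ 1 / 2) :
    Real.log (1 - r)⁻¹ ≤ 2 * s := by
  refine (Real.log_le_sub_one_of_pos (inv_pos.2 (by linarith))).trans ?_
  rw [inv_eq_one_div, div_sub_one (by linarith), div_le_iff₀ (by linarith)]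
  nlinarith

lemma hilbertDist_le {n : ℕ} {Ω : Set (EuclideanSpace ℝ (Fin n))}
    {x y : EuclideanSpace ℝ (Fin n)} {s : ℝ} (hs : s ≤ 1 / 2)
    (hxy : exitRate Ω x (y - x) ≤ s) (hyx : exitRate Ω y (x - y) ≤ s) :
    hilbertDist Ω x y ≤ 4 * s := by
  unfold hilbertDist
  rw [Real.log_mul (inv_pos.2 (by linarith)).ne' (inv_pos.2 (by linarith)).ne']
  linarith [log_inv_one_sub_le (exitRate_nonneg _ _) hxy hs,
    log_inv_one_sub_le (exitRate_nonneg _ _) hyx hs]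

/-- A map on a convex set that satisfies a Lipschitz estimate on a uniform small scale is
Lipschitz. -/
lemma lipschitzOnWith_of_forall_dist_le {E X : Type*} [NormedAddCommGroup E] [NormedSpace ℝ E]
    [PseudoMetricSpace X] {f : E → X} {s : Set E} (hs : Convex ℝ s) {K : ℝ≥0} {δ : ℝ} (hδ : 0 < δ)
    (h : ∀ p ∈ s, ∀ q ∈ s, dist p q ≤ δ → dist (f p) (f q) ≤ K * dist p q) :
    LipschitzOnWith K f s := by
  -- Each induction step doubles the admissible scale by inserting the midpoint, which convexity
  -- keeps in `s`; the constant `K` is unchanged.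
  have key : ∀ (n : ℕ), ∀ p ∈ s, ∀ q ∈ s, dist p q ≤ 2 ^ n * δ →
      dist (f p) (f q) ≤ K * dist p q := by
    intro n
    induction n with
    | zero => simpa using h
    | succ n ih =>
      intro p hp q hq hpq
      have hm : midpoint ℝ p q ∈ s := hs.midpoint_mem hp hq
      have e1 : dist p (midpoint ℝ p q) = dist p q / 2 := by
        rw [dist_left_midpoint]
        norm_num
        ring
      have e2 : dist (midpoint ℝ p q) q = dist p q / 2 := by
        rw [dist_midpoint_right]
        norm_num
        ring
      have hle : dist p q / 2 ≤ 2 ^ n * δ := by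
        rw [pow_succ] at hpq
        linarith
      have i1 := ih p hp _ hm (e1.trans_le hle)
      have i2 := ih _ hm q hq (e2.trans_le hle)
      rw [e1] at i1
      rw [e2] at i2
      linarith [dist_triangle (f p) (f (midpoint ℝ p q)) (f q)]
  refine LipschitzOnWith.of_dist_le_mul fun p hp q hq => ?_
  obtain ⟨n, hn⟩ := pow_unbounded_of_one_lt (dist p q / δ) (one_lt_two : (1 : ℝ) < 2)
  exact key n p hp q hq (by rw [div_lt_iff₀ hδ] at hn; exact hn.le)

/-! ### Parametrizations of pieces of the domain -/

/-- A point of the affine patch as a point of the Hilbert geometry of `D'` (with an arbitrary value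
outside of `D'`). -/
def toHilbert (x : EuclideanSpace ℝ (Fin 3)) : HilbertSpaceOf domD_isProperlyConvex :=
  open Classical in
  if h : x ∈ domD then ⟨x, h⟩ else ⟨!₂[1, 1, 0], by simp [mem_domD]⟩

lemma toHilbert_point (p : HilbertSpaceOf domD_isProperlyConvex) : toHilbert p.point = p :=
  dif_pos p.2

lemma point_toHilbert {x : EuclideanSpace ℝ (Fin 3)} (h : x ∈ domD) :
    (toHilbert x).point = x :=
  congrArg HilbertSpaceOf.point (dif_pos h : toHilbert x = Subtype.mk x h)

lemma dist_toHilbert {x y : EuclideanSpace ℝ (Fin 3)} (hx : x ∈ domD) (hy : y ∈ domD) :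
    dist (toHilbert x) (toHilbert y) = hilbertDist domD x y := by
  change hilbertDist domD (toHilbert x).point (toHilbert y).point = _
  rw [point_toHilbert hx, point_toHilbert hy]

lemma setOf_point_mem {E : Set (EuclideanSpace ℝ (Fin 3))} (hE : E ⊆ domD) :
    {p : HilbertSpaceOf domD_isProperlyConvex | p.point ∈ E} = toHilbert '' E := by
  ext p
  constructor
  · exact fun h => ⟨p.point, h, toHilbert_point p⟩
  · rintro ⟨x, hx, rfl⟩
    change (toHilbert x).point ∈ E
    rwa [point_toHilbert (hE hx)]

/-- The part of the domain that lies over a box in the half-plane, at height at least `t` over the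
boundary. -/
def slab (B t : ℝ) : Set (EuclideanSpace ℝ (Fin 3)) :=
  {x | B⁻¹ ≤ x 1 ∧ |x 2| ≤ B ∧ graphFun x + t ≤ x 0}

lemma slab_subset_domD {B t : ℝ} (hB : 0 < B) (ht : 0 < t) : slab B t ⊆ domD := by
  rintro x ⟨h1, -, h0⟩
  have : 0 < B⁻¹ := inv_pos.2 hB
  unfold graphFun at h0
  exact mem_domD.2 ⟨by linarith, by linarith⟩

/-- Convexity lets the estimate at small scale extend to the whole slab in `exists_lipschitzOnWith`.
-/
lemma convex_slab {B t : ℝ} (hB : 0 < B) : Convex ℝ (slab B t) := by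
  rintro x ⟨hx1, hx2, hx0⟩ y ⟨hy1, hy2, hy0⟩ a b ha hb hab
  have hBi : 0 < B⁻¹ := inv_pos.2 hB
  have hl := (strictConcaveOn_log_Ioi.concaveOn).2 (mem_Ioi.2 (hBi.trans_le hx1))
    (mem_Ioi.2 (hBi.trans_le hy1)) ha hb hab
  have h1 := (convex_Ici B⁻¹) hx1 hy1 ha hb hab
  have h2 := (convex_Icc (-B) B) (abs_le.1 hx2) (abs_le.1 hy2) ha hb hab
  have hsq : (a * x 2 + b * y 2) ^ 2 ≤ a * x 2 ^ 2 + b * y 2 ^ 2 := by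
    obtain rfl : b = 1 - a := by linarith
    nlinarith [mul_nonneg (mul_nonneg ha hb) (sq_nonneg (x 2 - y 2))]
  unfold graphFun at hx0 hy0
  simp only [smul_eq_mul] at hl h1 h2
  refine ⟨by simpa using h1, abs_le.2 (by simpa using h2), ?_⟩
  simp only [graphFun, PiLp.add_apply, PiLp.smul_apply, smul_eq_mul]
  have := mul_le_mul_of_nonneg_left hx0 ha
  have := mul_le_mul_of_nonneg_left hy0 hb
  obtain rfl : b = 1 - a := by linarith
  nlinarith

lemma measurableSet_slab (B t : ℝ) : MeasurableSet (slab B t) := by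
  have : slab B t = {x | B⁻¹ ≤ x 1} ∩ ({x | |x 2| ≤ B} ∩
      {x | x 2 ^ 2 / 2 - Real.log (x 1) + t ≤ x 0}) := rfl
  rw [this]
  exact (measurableSet_le (by fun_prop) (by fun_prop)).inter
    ((measurableSet_le (by fun_prop) (by fun_prop)).inter
      (measurableSet_le (by fun_prop) (by fun_prop)))

/-- The anisotropic scaling `p ↦ (t p₀, p₁, √t p₂)`. -/
def scaling (t : ℝ) : (Fin 3 → ℝ) →ₗ[ℝ] (Fin 3 → ℝ) :=
  Matrix.toLin' (Matrix.diagonal ![t, 1, √t])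

lemma scaling_apply (t : ℝ) (p : Fin 3 → ℝ) : scaling t p = ![t * p 0, p 1, √t * p 2] := by
  ext i
  fin_cases i <;> simp [scaling, Matrix.mulVec_diagonal]

lemma det_scaling (t : ℝ) : LinearMap.det (scaling t) = t * √t := by
  simp [scaling, LinearMap.det_toLin', Fin.prod_univ_three]

/-- The scaling as a map into Euclidean space. -/
def scalingE (t : ℝ) : (Fin 3 → ℝ) →ₗ[ℝ] EuclideanSpace ℝ (Fin 3) :=
  (WithLp.linearEquiv 2 ℝ (Fin 3 → ℝ)).symm.toLinearMap ∘ₗ scaling t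

lemma scalingE_apply (t : ℝ) (p : Fin 3 → ℝ) :
    scalingE t p = !₂[t * p 0, p 1, √t * p 2] := by
  rw [← scaling_apply]
  rfl

lemma scalingE_bijective {t : ℝ} (ht : 0 < t) : Function.Bijective (scalingE t) := by
  have hs : √t ≠ 0 := (Real.sqrt_pos.2 ht).ne'
  constructor
  · intro p q e
    rw [scalingE_apply, scalingE_apply] at e
    have e' := congrFun (congrArg WithLp.ofLp e)
    ext i
    have := e' i
    fin_cases i <;> simpa [ht.ne', hs] using this
  · intro x
    refine ⟨![x 0 / t, x 1, x 2 / √t], ?_⟩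
    rw [scalingE_apply]
    ext i
    fin_cases i
    · simp [mul_div_cancel₀ _ ht.ne']
    · simp
    · simp [mul_div_cancel₀ _ hs]

lemma continuous_scalingE (t : ℝ) : Continuous (scalingE t) :=
  LinearMap.continuous_of_finiteDimensional _

lemma volume_preimage_scalingE {t : ℝ} (ht : 0 < t) (E : Set (EuclideanSpace ℝ (Fin 3))) :
    volume (scalingE t ⁻¹' E) = ENNReal.ofReal (t * √t)⁻¹ * volume E := by
  have hdet : 0 < t * √t := mul_pos ht (Real.sqrt_pos.2 ht)
  have h : scalingE t ⁻¹' E = scaling t ⁻¹' (WithLp.toLp 2 ⁻¹' E) := rfl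
  rw [h, Measure.addHaar_preimage_linearMap _ (by rw [det_scaling]; exact hdet.ne'), det_scaling,
    abs_of_pos (inv_pos.2 hdet)]
  congr 1
  exact ((PiLp.volume_preserving_toLp (Fin 3)).measure_preimage_equiv
    (f := MeasurableEquiv.toLp 2 (Fin 3 → ℝ)) E)

/-- The scaling turns the box of sides `t`, `1`, `√t` into a cube, that is, a ball of the sup
metric. Exit rates are therefore at most `dist p q / c`, with `c` independent of `t`. -/
lemma exists_lipschitzOnWith {B κ : ℝ} (hB : 1 ≤ B) (hκ : 0 < κ) :
    ∃ K : ℝ≥0, ∀ t, κ ≤ t →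
      LipschitzOnWith K (toHilbert ∘ scalingE t) (scalingE t ⁻¹' slab B t) := by
  obtain ⟨c, hc, h⟩ := exists_exitRate_le hB hκ
  refine ⟨(4 / c).toNNReal, fun t ht => ?_⟩
  have hB0 : 0 < B := by linarith
  have ht0 : 0 < t := hκ.trans_le ht
  have hexit : ∀ p q : Fin 3 → ℝ, p ≠ q → scalingE t p ∈ slab B t →
      exitRate domD (scalingE t p) (scalingE t q - scalingE t p) ≤ dist p q / c := by
    intro p q hpq hp
    have hd : 0 < dist p q := dist_pos.2 hpq
    have hi : ∀ i, |q i - p i| ≤ dist p q := fun i => by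
      rw [abs_sub_comm, ← Real.dist_eq]
      exact dist_le_pi_dist p q i
    have hs := Real.sqrt_nonneg t
    refine h _ _ t _ hp.1 hp.2.1 ht hp.2.2 (by positivity) ?_ ?_ ?_
    · have : |t * q 0 - t * p 0| ≤ t * dist p q := by
        rw [← mul_sub, abs_mul, abs_of_pos ht0]
        exact mul_le_mul_of_nonneg_left (hi 0) ht0.le
      simp only [scalingE_apply, PiLp.sub_apply, Matrix.cons_val_zero]
      refine this.trans_eq ?_
      field_simp
    · simp only [scalingE_apply, PiLp.sub_apply, Matrix.cons_val_one, Matrix.cons_val_zero]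
      refine (hi 1).trans_eq ?_
      field_simp
    · have : |√t * q 2 - √t * p 2| ≤ √t * dist p q := by
        rw [← mul_sub, abs_mul, abs_of_nonneg hs]
        exact mul_le_mul_of_nonneg_left (hi 2) hs
      simp only [scalingE_apply, PiLp.sub_apply, Matrix.cons_val]
      refine this.trans_eq ?_
      field_simp
  -- The scale `c / 2` is what makes `dist p q / c ≤ 1 / 2`, as `hilbertDist_le` demands.
  refine lipschitzOnWith_of_forall_dist_le ((convex_slab hB0).linear_preimage (scalingE t))
    (δ := c / 2) (by positivity) fun p hp q hq hpq => ?_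
  rcases eq_or_ne p q with rfl | hne
  · simp
  rw [Function.comp_apply, Function.comp_apply, dist_toHilbert (slab_subset_domD hB0 ht0 hp)
    (slab_subset_domD hB0 ht0 hq)]
  refine (hilbertDist_le (s := dist p q / c) ?_ (hexit p q hne hp) ?_).trans_eq ?_
  · rw [div_le_iff₀ hc]
    linarith
  · rw [dist_comm]
    exact hexit q p hne.symm hq
  · rw [Real.coe_toNNReal _ (by positivity)]
    ring

/-! ### Upper bounds for the Busemann volume -/

lemma busemannVolume_mono {n : ℕ} {Ω : Set (EuclideanSpace ℝ (Fin n))} (h : IsProperlyConvex Ω)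
    {E F : Set (EuclideanSpace ℝ (Fin n))} (hEF : E ⊆ F) :
    busemannVolume h E ≤ busemannVolume h F :=
  measure_mono fun _ hp => hEF hp

lemma busemannVolume_iUnion_le {n : ℕ} {Ω : Set (EuclideanSpace ℝ (Fin n))}
    (h : IsProperlyConvex Ω) (E : ℕ → Set (EuclideanSpace ℝ (Fin n))) :
    busemannVolume h (⋃ i, E i) ≤ ∑' i, busemannVolume h (E i) := by
  unfold busemannVolume
  refine (measure_mono fun p hp => ?_).trans (measure_iUnion_le _)
  simpa using hp

/-- At height of the order of `t` over the boundary, and over a bounded part of the half-plane,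
the density of the Busemann volume is at most of the order of `t ^ (-3/2)`. -/
lemma exists_busemannVolume_le {B κ : ℝ} (hB : 1 ≤ B) (hκ : 0 < κ) :
    ∃ M : ℝ≥0∞, M ≠ ∞ ∧ ∀ t, κ ≤ t → ∀ E ⊆ slab B t,
      busemannVolume domD_isProperlyConvex E ≤
        M * (ENNReal.ofReal (t * √t)⁻¹ * volume E) := by
  obtain ⟨K, hK⟩ := exists_lipschitzOnWith hB hκ
  refine ⟨volume (Metric.ball (0 : EuclideanSpace ℝ (Fin 3)) (1 / 2)) * (K : ℝ≥0∞) ^ (3 : ℝ),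
    ENNReal.mul_ne_top measure_ball_lt_top.ne
      (ENNReal.rpow_ne_top_of_nonneg (by norm_num) ENNReal.coe_ne_top), fun t ht E hE => ?_⟩
  have ht0 : 0 < t := hκ.trans_le ht
  have hEdom := hE.trans (slab_subset_domD (by linarith) ht0)
  have himg : toHilbert '' E = (toHilbert ∘ scalingE t) '' (scalingE t ⁻¹' E) := by
    rw [image_comp, image_preimage_eq _ (scalingE_bijective ht0).2]
  have hH := ((hK t ht).mono (preimage_mono hE)).hausdorffMeasure_image_le
    (d := 3) (by norm_num)
  -- With the sup metric on `Fin 3 → ℝ`, three-dimensional Hausdorff measure is exactly Lebesgue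
  -- measure; this is why the charts start there.
  have hvol : (Measure.hausdorffMeasure 3 : Measure (Fin 3 → ℝ)) = volume := by
    simpa using hausdorffMeasure_pi_real (ι := Fin 3)
  rw [busemannVolume, busemannMeasure, setOf_point_mem hEdom, himg, Measure.smul_apply,
    smul_eq_mul, mul_assoc, ← volume_preimage_scalingE ht0, ← hvol]
  exact mul_le_mul_right hH _

lemma busemannVolume_inter_domD (E : Set (EuclideanSpace ℝ (Fin 3))) :
    busemannVolume domD_isProperlyConvex (E ∩ domD) = busemannVolume domD_isProperlyConvex E := by
  unfold busemannVolume
  congr 1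
  ext p
  exact and_iff_left p.2

/-- The pieces `slab (m + 1) (m + 1)⁻¹` exhaust the domain. -/
lemma exists_mem_slab {x : EuclideanSpace ℝ (Fin 3)} (hx : x ∈ domD) :
    ∃ m : ℕ, x ∈ slab (m + 1) ((m : ℝ) + 1)⁻¹ := by
  obtain ⟨h1, h0⟩ := mem_domD.1 hx
  have ht : 0 < x 0 - graphFun x := by
    unfold graphFun
    linarith
  obtain ⟨m, hm⟩ := exists_nat_ge (max (x 1)⁻¹ (max |x 2| (x 0 - graphFun x)⁻¹))
  obtain ⟨m1, hm'⟩ := max_le_iff.1 hm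
  obtain ⟨m2, m0⟩ := max_le_iff.1 hm'
  refine ⟨m, inv_le_of_inv_le₀ h1 (by linarith), by linarith, ?_⟩
  have := inv_le_of_inv_le₀ ht (m0.trans (by linarith : (m : ℝ) ≤ m + 1))
  linarith

lemma iUnion_inter_slab {E : Set (EuclideanSpace ℝ (Fin 3))} (hE : E ⊆ domD) :
    ⋃ m : ℕ, E ∩ slab (m + 1) ((m : ℝ) + 1)⁻¹ = E := by
  rw [← inter_iUnion, inter_eq_left]
  exact fun x hx => mem_iUnion.2 (exists_mem_slab (hE hx))

/-- Countably many slabs exhaust the domain, and on each of them the Busemann volume is bounded by a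
finite multiple of Lebesgue measure. -/
lemma busemannVolume_eq_zero {E : Set (EuclideanSpace ℝ (Fin 3))} (hE : volume E = 0) :
    busemannVolume domD_isProperlyConvex E = 0 := by
  rw [← busemannVolume_inter_domD, ← iUnion_inter_slab (inter_subset_right (s := E))]
  refine le_antisymm ((busemannVolume_iUnion_le _ _).trans_eq ?_) zero_le
  refine ENNReal.tsum_eq_zero.2 fun m => ?_
  obtain ⟨M, -, h⟩ := exists_busemannVolume_le (B := (m : ℝ) + 1) (κ := ((m : ℝ) + 1)⁻¹)
    (by linarith [(m.cast_nonneg : (0 : ℝ) ≤ m)]) (by positivity)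
  refine le_antisymm ((h _ le_rfl _ inter_subset_right).trans_eq ?_) zero_le
  rw [measure_mono_null (inter_subset_left.trans inter_subset_left) hE]
  simp

theorem busemannVolume_domainOver_lt_top {R : Set (EuclideanSpace ℝ (Fin 2))} (hR : IsCompact R)
    (hsub : R ⊆ halfPlane) {k : ℝ} (hk : 0 < k) :
    busemannVolume domD_isProperlyConvex (domainOver R k) < ∞ := by
  obtain ⟨B, hB, hRB⟩ := exists_bound_of_isCompact hR hsub
  obtain ⟨M, hM, hvol⟩ := exists_busemannVolume_le hB hk
  have hB0 : 0 < B := by linarith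
  have hsk : 0 < √k := Real.sqrt_pos.2 hk
  -- Layers of heights between `4 ^ n * k` and `4 ^ (n + 1) * k`: Lebesgue volume is of order `4 ^
  -- n`, the density at most of order `8 ^ (-n)`, and the products form a geometric series of ratio
  -- `1 / 2`. Powers of `4` keep the square roots explicit.
  let E : ℕ → Set (EuclideanSpace ℝ (Fin 3)) := fun n =>
    {x | x ∈ slab B (4 ^ n * k) ∧ x 1 ≤ B ∧ x 0 ≤ graphFun x + 4 ^ (n + 1) * k}
  have hcover : domainOver R k ⊆ ⋃ n, E n := by
    intro x hx
    obtain ⟨h1, h1', h2⟩ := hRB _ hx.1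
    replace h1 : B⁻¹ ≤ x 1 := by simpa [proj] using h1
    replace h1' : x 1 ≤ B := by simpa [proj] using h1'
    replace h2 : |x 2| ≤ B := by simpa [proj] using h2
    have hx0 : k + graphFun x < x 0 := (mem_horoball.1 hx.2).2
    obtain ⟨n, hn, hn'⟩ := exists_nat_pow_near (x := (x 0 - graphFun x) / k) (y := 4)
      (by rw [le_div_iff₀ hk]; linarith) (by norm_num)
    rw [le_div_iff₀ hk] at hn
    rw [div_lt_iff₀ hk] at hn'
    exact mem_iUnion.2 ⟨n, ⟨h1, h2, by linarith⟩, h1', by linarith⟩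
  have hEvol : ∀ n, volume (E n) ≤
      ENNReal.ofReal (8 * B ^ 2 * (B ^ 2 / 2 + B + 4 * k) * 4 ^ n) := by
    intro n
    have hp : (1 : ℝ) ≤ 4 ^ n := one_le_pow₀ (by norm_num)
    let a : Fin 3 → ℝ := ![(B ^ 2 / 2 + B + 4 * k) * 4 ^ n, B, B]
    have hsubE : E n ⊆ {x | ∀ i, |x i| ≤ a i} := by
      rintro x ⟨⟨h1, h2, h0⟩, h1', h0'⟩
      have hBi : 0 < B⁻¹ := inv_pos.2 hB0
      have hx1 : 0 < x 1 := by linarith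
      have hlog : -B ≤ Real.log (x 1) := by
        refine le_trans ?_ (Real.log_le_log hBi h1)
        rw [Real.log_inv]
        linarith [Real.log_le_sub_one_of_pos hB0]
      have hlog' : Real.log (x 1) ≤ B := by linarith [Real.log_le_sub_one_of_pos hx1]
      have hx2 : x 2 ^ 2 ≤ B ^ 2 := by
        rw [← sq_abs]
        exact pow_le_pow_left₀ (abs_nonneg _) h2 2
      have hx2' := sq_nonneg (x 2)
      have hG : B ^ 2 / 2 + B ≤ (B ^ 2 / 2 + B) * 4 ^ n :=
        le_mul_of_one_le_right (by positivity) hp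
      have hkp : 0 ≤ 4 ^ n * k := by positivity
      have e : (4 : ℝ) ^ (n + 1) * k = 4 * k * 4 ^ n := by ring
      unfold graphFun at h0 h0'
      intro i
      fin_cases i
      · simp only [a, Fin.zero_eta, Matrix.cons_val_zero]
        rw [abs_le]
        constructor <;> nlinarith
      · simpa [a, abs_of_pos hx1] using h1'
      · simpa [a] using h2
    refine (measure_mono hsubE).trans_eq ?_
    rw [volume_setOf_abs_le, Fin.prod_univ_three]
    simp only [a, Matrix.cons_val_zero, Matrix.cons_val_one, Matrix.cons_val]
    rw [← ENNReal.ofReal_mul (by positivity), ← ENNReal.ofReal_mul (by positivity)]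
    congr 1
    ring
  have hpiece : ∀ n, busemannVolume domD_isProperlyConvex (E n) ≤
      M * ENNReal.ofReal
        (8 * B ^ 2 * (B ^ 2 / 2 + B + 4 * k) / (k * √k) * (1 / 2) ^ n) := by
    intro n
    have hp : (1 : ℝ) ≤ 4 ^ n := one_le_pow₀ (by norm_num)
    refine (hvol (4 ^ n * k) (le_mul_of_one_le_left hk.le hp) (E n) fun x hx => hx.1).trans ?_
    refine mul_le_mul_right ((mul_le_mul_right (hEvol n) _).trans_eq ?_) M
    rw [← ENNReal.ofReal_mul (by positivity)]
    congr 1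
    have hsq : √((4 : ℝ) ^ n * k) = 2 ^ n * √k := by
      rw [Real.sqrt_mul (by positivity), show (4 : ℝ) ^ n = (2 ^ n) ^ 2 by
        rw [← pow_mul, mul_comm, pow_mul]; norm_num, Real.sqrt_sq (by positivity)]
    rw [hsq, one_div, inv_pow]
    field_simp
  refine (busemannVolume_mono _ hcover).trans_lt ((busemannVolume_iUnion_le _ _).trans_lt ?_)
  refine (ENNReal.tsum_le_tsum hpiece).trans_lt ?_
  rw [ENNReal.tsum_mul_left]
  exact ENNReal.mul_lt_top hM.lt_top
    ((summable_geometric_of_lt_one (by norm_num) (by norm_num)).mul_left _).tsum_ofReal_lt_top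

/-! ### Invariance of the Busemann volume -/

lemma smul_mem_domD (g : groupL) {x : EuclideanSpace ℝ (Fin 3)} : g • x ∈ domD ↔ x ∈ domD := by
  have h : domD = horoball 0 := by
    ext y
    rw [mem_domD, mem_horoball, zero_add]
  rw [h, smul_mem_horoball]

/-- The action is affine; this is the form in which `exitRate_smul` needs it after unfolding the
gauge. -/
lemma smul_add_smul_sub (g : groupL) (x y : EuclideanSpace ℝ (Fin 3)) (r : ℝ) :
    g • x + r • (g • y - g • x) = g • (x + r • (y - x)) := by
  obtain ⟨a, b, rfl⟩ := exists_eq_elemL g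
  simp only [smul_def3 _ (mat_elemL a b)]
  ext i
  fin_cases i <;> simp <;> ring

lemma exitRate_smul (g : groupL) (x y : EuclideanSpace ℝ (Fin 3)) :
    exitRate domD (g • x) (g • y - g • x) = exitRate domD x (y - x) := by
  simp only [exitRate, gauge_def', mem_ofPred_eq, smul_add_smul_sub, smul_mem_domD]

lemma hilbertDist_smul (g : groupL) (x y : EuclideanSpace ℝ (Fin 3)) :
    hilbertDist domD (g • x) (g • y) = hilbertDist domD x y := by
  simp only [hilbertDist, exitRate_smul]

/-- An element of `L'` as an isometry of the Hilbert geometry of `D'`. -/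
def hilbertIsometry (g : groupL) :
    HilbertSpaceOf domD_isProperlyConvex ≃ᵢ HilbertSpaceOf domD_isProperlyConvex where
  toFun p := ⟨g • p.point, (smul_mem_domD g).2 p.2⟩
  invFun p := ⟨g⁻¹ • p.point, (smul_mem_domD g⁻¹).2 p.2⟩
  left_inv p := Subtype.ext (inv_smul_smul g p.point)
  right_inv p := Subtype.ext (smul_inv_smul g p.point)
  isometry_toFun := Isometry.of_dist_eq fun p q => hilbertDist_smul g p.point q.point

lemma busemannVolume_preimage_smul (g : groupL) (E : Set (EuclideanSpace ℝ (Fin 3))) :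
    busemannVolume domD_isProperlyConvex ((fun x => g • x) ⁻¹' E) =
      busemannVolume domD_isProperlyConvex E := by
  have h := (hilbertIsometry g).hausdorffMeasure_preimage (3 : ℝ) {p | p.point ∈ E}
  simp only [busemannVolume, busemannMeasure, Measure.smul_apply]
  congr 1

/-- The Borel structure of the Hilbert metric is the Euclidean one. -/
lemma measurable_point :
    Measurable (HilbertSpaceOf.point (h := domD_isProperlyConvex)) := by
  -- A continuous injective image of a Borel set is Borel (Lusin–Souslin), so the Lipschitz charts
  -- suffice and no lower bound on the Hilbert metric is needed.
  have key : ∀ S : Set (EuclideanSpace ℝ (Fin 3)), MeasurableSet S → S ⊆ domD →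
      MeasurableSet (toHilbert '' S) := by
    intro S hS hSd
    rw [← iUnion_inter_slab hSd, image_iUnion]
    refine MeasurableSet.iUnion fun m => ?_
    have hm : (0 : ℝ) < m + 1 := by positivity
    have ht : (0 : ℝ) < ((m : ℝ) + 1)⁻¹ := inv_pos.2 hm
    obtain ⟨K, hK⟩ := exists_lipschitzOnWith (B := (m : ℝ) + 1) (κ := ((m : ℝ) + 1)⁻¹)
      (by linarith [(m.cast_nonneg : (0 : ℝ) ≤ m)]) ht
    have hc := ((hK _ le_rfl).mono
      (preimage_mono (inter_subset_right (s := S)))).continuousOn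
    have hmeas : MeasurableSet (scalingE ((m : ℝ) + 1)⁻¹ ⁻¹' (S ∩ slab (m + 1) ((m : ℝ) + 1)⁻¹)) :=
      (continuous_scalingE _).measurable (hS.inter (measurableSet_slab _ _))
    have himg := hmeas.image_of_continuousOn_injOn hc (by
      intro p hp q hq e
      have e' := congrArg HilbertSpaceOf.point e
      rw [Function.comp_apply, Function.comp_apply, point_toHilbert (hSd hp.1),
        point_toHilbert (hSd hq.1)] at e'
      exact (scalingE_bijective ht).1 e')
    rwa [image_comp, image_preimage_eq _ (scalingE_bijective ht).2] at himg
  intro S hS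
  have h : HilbertSpaceOf.point (h := domD_isProperlyConvex) ⁻¹' S = toHilbert '' (S ∩ domD) := by
    rw [← setOf_point_mem inter_subset_right]
    ext p
    exact (and_iff_left p.2).symm
  rw [h]
  exact key _ (hS.inter domD_isProperlyConvex.isOpen.measurableSet) inter_subset_right

theorem busemannVolume_le_of_isFundamentalDomain [Countable Γ] {k : ℝ}
    {E F : Set (EuclideanSpace ℝ (Fin 3))} (hE : E ⊆ horoball k) (hF : F ⊆ horoball k)
    (hFmeas : MeasurableSet F)
    (hEdom : IsFundamentalDomain Γ E (volume.restrict (horoball k)))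
    (hFdom : IsFundamentalDomain Γ F (volume.restrict (horoball k))) :
    busemannVolume domD_isProperlyConvex E ≤ busemannVolume domD_isProperlyConvex F := by
  let μ : Measure (EuclideanSpace ℝ (Fin 3)) :=
    ((busemannMeasure domD_isProperlyConvex).map HilbertSpaceOf.point).restrict (horoball k)
  have hμ : ∀ S, MeasurableSet S →
      μ S = busemannVolume domD_isProperlyConvex (S ∩ horoball k) := fun S hS => by
    rw [Measure.restrict_apply hS,
      Measure.map_apply measurable_point (hS.inter (measurableSet_horoball k))]
    rfl
  -- Absolute continuity makes sets that are fundamental domains for Lebesgue measure fundamental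
  -- domains for `μ` as well.
  have hac : μ ≪ volume.restrict (horoball k) := by
    refine Measure.AbsolutelyContinuous.mk fun S hS h0 => ?_
    rw [Measure.restrict_apply hS] at h0
    rw [hμ S hS, busemannVolume_eq_zero h0]
  have hcont : ∀ g : groupL, Continuous fun x : EuclideanSpace ℝ (Fin 3) => g • x := fun g => by
    obtain ⟨a, b, rfl⟩ := exists_eq_elemL g
    simp only [smul_def3 _ (mat_elemL a b)]
    refine (PiLp.continuous_toLp 2 _).comp (continuous_pi fun i => ?_)
    fin_cases i <;> simp <;> fun_prop
  have : MeasurableConstSMul Γ (EuclideanSpace ℝ (Fin 3)) := ⟨fun g => (hcont g.1).measurable⟩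
  have : SMulInvariantMeasure Γ (EuclideanSpace ℝ (Fin 3)) μ := ⟨fun g S hS => by
    change μ ((fun x => g.1 • x) ⁻¹' S) = μ S
    rw [hμ S hS, hμ _ ((hcont g.1).measurable hS), ← busemannVolume_preimage_smul g.1 (S ∩ horoball k)]
    congr 1
    ext x
    exact and_congr_right fun _ => (smul_mem_horoball g.1).symm⟩
  have heq : μ E = μ F := (hEdom.mono hac).measure_eq (hFdom.mono hac)
  -- The set `E` need not be Borel, so its volume is only bounded by its pushforward measure.
  -- Equality is available for the measurable `F`, and the one-sided bound is enough for finiteness.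
  calc busemannVolume domD_isProperlyConvex E
      ≤ Measure.map HilbertSpaceOf.point (busemannMeasure domD_isProperlyConvex) E :=
        Measure.le_map_apply measurable_point.aemeasurable E
    _ = μ E := (Measure.restrict_eq_self _ hE).symm
    _ = μ F := heq
    _ = busemannVolume domD_isProperlyConvex F := by rw [hμ F hFmeas, inter_eq_left.2 hF]

end CuspVolume

end

theorem mainTheorem4 (Γ : Subgroup CuspVolume.groupL) (hΓ : CuspVolume.IsLatticeIn Γ) :
    (∃ R : Set (EuclideanSpace ℝ (Fin 2)), CuspVolume.IsCompactFundamentalDomain Γ R) ∧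
    (∀ R : Set (EuclideanSpace ℝ (Fin 2)), CuspVolume.IsCompactFundamentalDomain Γ R →
      (∀ k : ℝ, 0 < k →
        IsFundamentalDomain Γ (CuspVolume.domainOver R k)
          (volume.restrict (CuspVolume.horoball k)) ∧
        CuspVolume.busemannVolume CuspVolume.domD_isProperlyConvex
          (CuspVolume.domainOver R k) < ∞) ∧
      (∃ C : ℝ, 0 < C ∧ ∃ N : ℝ, ∀ k : ℝ, 0 < k → ∀ x ∈ CuspVolume.domainOver R k, N < x 0 →
        ENNReal.ofReal (C * x 0 ^ (3 / 2 : ℝ)) <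
          volume (CuspVolume.hilbertUnitBall CuspVolume.domD x))) ∧
    (∀ k : ℝ, 0 < k → ∀ E : Set (EuclideanSpace ℝ (Fin 3)), E ⊆ CuspVolume.horoball k →
      IsFundamentalDomain Γ E (volume.restrict (CuspVolume.horoball k)) →
      CuspVolume.busemannVolume CuspVolume.domD_isProperlyConvex E < ∞) := by
  have hR := CuspVolume.exists_isCompactFundamentalDomain hΓ
  refine ⟨hR, fun R hR => ⟨fun k hk => ⟨CuspVolume.isFundamentalDomain_domainOver hR k,
    CuspVolume.busemannVolume_domainOver_lt_top hR.isCompact hR.subset hk⟩,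
    CuspVolume.exists_lt_volume_hilbertUnitBall hR.isCompact hR.subset⟩, fun k hk E hE hEdom => ?_⟩
  obtain ⟨R, hR⟩ := hR
  have : Countable Γ := CuspVolume.countable_of_discreteTopology hΓ.discrete
  exact (CuspVolume.busemannVolume_le_of_isFundamentalDomain hE Set.inter_subset_right
    (CuspVolume.measurableSet_domainOver hR.isCompact.measurableSet k) hEdom
    (CuspVolume.isFundamentalDomain_domainOver hR k)).trans_lt
    (CuspVolume.busemannVolume_domainOver_lt_top hR.isCompact hR.subset hk)
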